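/- Let $X\subseteq\mathbb{R}^d$ be Lebesgue measurable, equipped with the $\sigma$-algebra $\mathcal{F}$ of its Lebesgue-measurable subsets, and let $\|\cdot\|$ be a norm on $\mathbb{R}^d$. Let $\pi,\hat\pi:\overline{X}\to(0,\infty)$ be continuous and strictly positive on the closure of $X$, with $\int_X\pi(x)\,dx=1$; write $\pi$ also for the distribution on $X$ with this density. Let $q$ be a proposal density on $X$: $q\ge 0$ is jointly measurable and $\int_X q(x,y)\,dy=1$ for all $x\in X$. Put $$r(x,y)=\frac{\pi(y)q(y,x)}{\pi(x)q(x,y)},\qquad r_1(x,y)=\frac{\hat\pi(y)q(y,x)}{\hat\pi(x)q(x,y)},\qquad r_2(x,y)=\frac{\pi(y)/\hat\pi(y)}{\pi(x)/\hat\pi(x)},$$ $\alpha_{MH}=1\wedge r$ and $\alpha_{DA}=(1\wedge r_1)(1\wedge r_2)$. For $\alpha\in\{\alpha_{MH},\alpha_{DA}\}$ let $$P(x,dy)=q(x,y)\alpha(x,y)\,dy+\Bigl[1-\int_X q(x,z)\alpha(x,z)\,dz\Bigr]\delta_x(dy);$$ this is the Metropolis-Hastings kernel $P_{MH}$, respectively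 the delayed-acceptance kernel $P_{DA}$. A Markov kernel $P$ with stationary distribution $\pi$ is called variance bounding if, for every $f\in L^2(\pi)$, the limit $\lim_{n\to\infty} n\,\mathrm{Var}\bigl[\frac1n\sum_{i=1}^n f(X_i)\bigr]$ exists and is finite, where $(X_i)_{i\ge1}$ is the Markov chain with kernel $P$ and $X_1\sim\pi$. Let $\Delta(x,y;q)=\log q(y,x)-\log q(x,y)$ and $$C(x)=\{y\in X:\ \mathrm{sign}[\log r_1(x,y)]\,\mathrm{sign}[\log r_2(x,y)]\ge 0\},$$ where points $y$ with $q(x,y)=0$ or $q(y,x)=0$ are counted as belonging to $C(x)$. Assume: 1. ($q$ is local) for every $\varepsilon>0$ there is $\rho<\infty$ such that $\int_{\{y\in X:\|y-x\|\ge\rho\}}q(x,y)\,dy<\varepsilon$ for all $x\in X$; 2. ($\hat\pi$ has heavier tails than $\pi$) there is $r_*>0$ such that, for all $x,y\in X$ with $\|x\|>r_*$ and $\|y\|>r_*$, $\hat\pi(x)\le\hat\pi(y)$ implies $\hat\pi(x)/\pi(x)\ge\hat\pi(y)/\pi(y)$; 3. for every $\varepsilon>0$ there are sets $D(x)\subseteq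 X$ $(x\in X)$ and a function $h:[0,\infty)\to[0,\infty)$ that is bounded on bounded intervals such that, for $\pi$-almost all $x$, $D(x)\in\mathcal{F}$, $\int_{D(x)^c}q(x,y)\,dy\le\varepsilon$ and $$\{y\in D(x):\ |\Delta(x,y;q)|>h(\|y-x\|)\}\subseteq C(x).$$ If $P_{MH}$ is variance bounding, then $P_{DA}$ is variance bounding. -/

import Mathlib

open MeasureTheory ProbabilityTheory Filter Topology
open scoped ENNReal

/-! ### The state space: a subset of `ℝᵈ` with its Lebesgue-measurable sets -/

/-- The points of a set `X ⊆ ℝᵈ`, as a type.  (A type of its own, since the subtype `↥X` carries the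
Borel σ-algebra.) -/
def StateSpace {d : ℕ} (X : Set (EuclideanSpace ℝ (Fin d))) : Type := {x // x ∈ X}

namespace StateSpace

variable {d : ℕ} {X : Set (EuclideanSpace ℝ (Fin d))}

/-- The inclusion of the state space in `ℝᵈ`. -/
def val (x : StateSpace X) : EuclideanSpace ℝ (Fin d) := Subtype.val x

/-- The inclusion of the state space in `ℝᵈ` with its σ-algebra of Lebesgue-measurable sets (the
`volume`-null-measurable sets). -/
def toNull (x : StateSpace X) : NullMeasurableSpace (EuclideanSpace ℝ (Fin d)) volume := x.val

/-- The σ-algebra of Lebesgue-measurable sets in `X`: the traces on `X` of the Lebesgue-measurable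
sets of `ℝᵈ`. -/
noncomputable instance : MeasurableSpace (StateSpace X) := MeasurableSpace.comap toNull inferInstance

/-- Lebesgue measure on the Lebesgue-measurable subsets of `X`. -/
noncomputable def lebesgue (X : Set (EuclideanSpace ℝ (Fin d))) : Measure (StateSpace X) :=
  Measure.comap toNull (volume : Measure (EuclideanSpace ℝ (Fin d))).completion

instance : SigmaFinite (lebesgue X) := by
  by_cases hf : Function.Injective (toNull (X := X)) ∧
      ∀ s : Set (StateSpace X), MeasurableSet s →
        NullMeasurableSet (toNull '' s) (volume : Measure (EuclideanSpace ℝ (Fin d))).completion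
  · have hms : ∀ n : ℕ, MeasurableSet {x : StateSpace X | x.val ∈ Metric.ball 0 (n : ℝ)} :=
      fun n => ⟨(Metric.ball (0 : EuclideanSpace ℝ (Fin d)) n : Set (EuclideanSpace ℝ (Fin d))),
        (measurableSet_ball (x := (0 : EuclideanSpace ℝ (Fin d)))).nullMeasurableSet, rfl⟩
    refine ⟨⟨⟨fun n => {x : StateSpace X | x.val ∈ Metric.ball 0 (n : ℝ)}, fun _ => trivial,
      fun n => ?_, ?_⟩⟩⟩
    · have h := Measure.comap_apply₀ toNull _ hf.1 hf.2 (hms n).nullMeasurableSet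
      refine lt_of_eq_of_lt (h.trans (Measure.completion_apply
        (volume : Measure (EuclideanSpace ℝ (Fin d))) _)) (lt_of_le_of_lt (measure_mono ?_)
          (measure_ball_lt_top (μ := (volume : Measure (EuclideanSpace ℝ (Fin d))))
            (x := 0) (r := (n : ℝ))))
      rintro _ ⟨x, hx, rfl⟩
      exact hx
    · refine Set.eq_univ_of_forall fun x => ?_
      obtain ⟨n, hn⟩ := exists_nat_gt (dist x.val 0)
      exact Set.mem_iUnion.2 ⟨n, hn⟩
  · have : lebesgue X = 0 := by
      unfold lebesgue Measure.comap
      exact dif_neg hf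
    rw [this]
    infer_instance

end StateSpace

/-! ### Markov chains, asymptotic variance and variance bounding kernels -/

section MarkovChain

variable {S : Type*} [MeasurableSpace S]

/-- The joint law `π(dx₀) P(x₀, dx₁) ⋯ P(xₙ₋₁, dxₙ)` of the first `n + 1` states of the Markov
chain with kernel `P` and initial distribution `π`. -/
noncomputable def pathLaw (P : Kernel S S) (π : Measure S) : (n : ℕ) → Measure (Fin (n + 1) → S)
  | 0 => π.map (fun x _ => x)
  | n + 1 =>
      (pathLaw P π n ⊗ₘ P.comap (fun x => x (Fin.last n)) (measurable_pi_apply _)).map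
        (fun p => Fin.snoc (α := fun _ => S) p.1 p.2)

/-- `v ∈ [0, ∞]` is the asymptotic variance of `h` under `P`: the limit, as `n → ∞`, of
`n Var[(h(X₁) + ⋯ + h(Xₙ)) / n]`, where `X₁, X₂, …` is the chain with kernel `P` and `X₁ ∼ π`.
(The sample size is written as `n + 1`.) -/
def IsAsymptoticVariance (P : Kernel S S) (π : Measure S) (h : S → ℝ) (v : ℝ≥0∞) : Prop :=
  Tendsto (fun n : ℕ => ((n + 1 : ℕ) : ℝ≥0∞) *
      evariance (fun x : Fin (n + 1) → S => (∑ i, h (x i)) / ((n + 1 : ℕ) : ℝ)) (pathLaw P π n))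
    atTop (𝓝 v)

/-- A Markov kernel `P` with stationary distribution `π` is variance bounding if the asymptotic
variance of every `h ∈ L²(π)` is finite. -/
def IsVarianceBounding (P : Kernel S S) (π : Measure S) : Prop :=
  ∀ h : S → ℝ, MemLp h 2 π → ∃ v : ℝ≥0∞, v < ∞ ∧ IsAsymptoticVariance P π h v

/-! ### Metropolis-Hastings and delayed-acceptance kernels -/

/-- The propose-accept-reject kernel with proposal density `q(x, y)` (with respect to `μ`) and
acceptance probability `α(x, y)`, which is
`q(x, y) α(x, y) μ(dy) + [1 - ∫ q(x, z) α(x, z) μ(dz)] δₓ(dy)`. -/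
noncomputable def proposeAcceptReject (μ : Measure S) [SFinite μ] (q α : S → S → ℝ) : Kernel S S :=
  Kernel.withDensity (Kernel.const S μ) (fun x y => ENNReal.ofReal (q x y * α x y)) +
    Kernel.withDensity Kernel.id (fun x _ => 1 - ∫⁻ z, ENNReal.ofReal (q x z * α x z) ∂μ)

/-- `q` is a proposal density: jointly measurable, non-negative, and `∫ q(x, y) μ(dy) = 1` for
all `x`. -/
structure IsProposalDensity (μ : Measure S) (q : S → S → ℝ) : Prop where
  measurable : Measurable (Function.uncurry q)
  nonneg : ∀ x y, 0 ≤ q x y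
  lintegral_eq_one : ∀ x, ∫⁻ y, ENNReal.ofReal (q x y) ∂μ = 1

end MarkovChain

section Ratios

variable {S : Type*}

/-- The Metropolis-Hastings ratio `r(x, y) = π(y) q(y, x) / (π(x) q(x, y))`. -/
noncomputable def ratioMH (π : S → ℝ) (q : S → S → ℝ) (x y : S) : ℝ :=
  (π y * q y x) / (π x * q x y)

/-- The ratio of the correction stage of delayed acceptance,
`r₂(x, y) = (π(y) / π'(y)) / (π(x) / π'(x))`, for the surrogate `π'`. -/
noncomputable def ratioDA₂ (π π' : S → ℝ) (x y : S) : ℝ :=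
  (π y / π' y) / (π x / π' x)

/-- The Metropolis-Hastings acceptance probability. -/
noncomputable def acceptMH (π : S → ℝ) (q : S → S → ℝ) (x y : S) : ℝ :=
  min 1 (ratioMH π q x y)

/-- The delayed-acceptance acceptance probability `[1 ∧ r₁(x, y)] [1 ∧ r₂(x, y)]`; the ratio `r₁` of
the screening stage is the Metropolis-Hastings ratio for the surrogate `π'`. -/
noncomputable def acceptDA (π π' : S → ℝ) (q : S → S → ℝ) (x y : S) : ℝ :=
  min 1 (ratioMH π' q x y) * min 1 (ratioDA₂ π π' x y)

/-- `Δ(x, y; q) = log q(y, x) - log q(x, y)`. -/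
noncomputable def logProposalRatio (q : S → S → ℝ) (x y : S) : ℝ :=
  Real.log (q y x) - Real.log (q x y)

/-- The "no problem" set `C(x) = {y : sign(log r₁(x, y)) sign(log r₂(x, y)) ≥ 0}`.
Since `Real.log 0 = 0`, it contains every `y` with `q(x, y) = 0` or `q(y, x) = 0`: such a `y` is
either never proposed, or both acceptance probabilities are zero. -/
def noProblemSet (π π' : S → ℝ) (q : S → S → ℝ) (x : S) : Set S :=
  {y | 0 ≤ Real.sign (Real.log (ratioMH π' q x y)) * Real.sign (Real.log (ratioDA₂ π π' x y))}

end Ratios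

section Euclidean

open StateSpace

variable {d : ℕ} {X : Set (EuclideanSpace ℝ (Fin d))}

/-- The distribution on `X` with density `π` with respect to Lebesgue measure. -/
noncomputable def target (π : StateSpace X → ℝ) : Measure (StateSpace X) :=
  (lebesgue X).withDensity (fun x => ENNReal.ofReal (π x))

/-- The Metropolis-Hastings kernel with target density `π` and proposal density `q`. -/
noncomputable def kernelMH (π : StateSpace X → ℝ) (q : StateSpace X → StateSpace X → ℝ) :
    Kernel (StateSpace X) (StateSpace X) :=
  proposeAcceptReject (lebesgue X) q (acceptMH π q)

/-- The delayed-acceptance kernel with target density `π`, surrogate `π'` and proposal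
density `q`. -/
noncomputable def kernelDA (π π' : StateSpace X → ℝ) (q : StateSpace X → StateSpace X → ℝ) :
    Kernel (StateSpace X) (StateSpace X) :=
  proposeAcceptReject (lebesgue X) q (acceptDA π π' q)

/-- The proposal `q` is local with respect to the norm `N`: for each `ε > 0` there is a radius `r`
with `∫_{B(x, r)ᶜ} q(x, y) dy < ε` for all `x ∈ X`, where `B(x, r) = {y ∈ X : N(y - x) < r}`. -/
def IsLocalProposal (N : Seminorm ℝ (EuclideanSpace ℝ (Fin d)))
    (q : StateSpace X → StateSpace X → ℝ) : Prop :=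
  ∀ ε : ℝ, 0 < ε → ∃ r : ℝ, ∀ x : StateSpace X,
    ∫⁻ y in {y : StateSpace X | N (y.val - x.val) < r}ᶜ, ENNReal.ofReal (q x y) ∂(lebesgue X)
      < ENNReal.ofReal ε

/-- `π'` has heavy tails with respect to `π`: there is `r > 0` such that, for `x, y ∈ X` with
`N x > r` and `N y > r`, `π'(x) ≤ π'(y)` implies `π'(x) / π(x) ≥ π'(y) / π(y)`. -/
def HasHeavyTails (N : Seminorm ℝ (EuclideanSpace ℝ (Fin d))) (π' π : StateSpace X → ℝ) : Prop :=
  ∃ r : ℝ, 0 < r ∧ ∀ x y : StateSpace X, r < N x.val → r < N y.val →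
    π' x ≤ π' y → π' y / π y ≤ π' x / π x

end Euclidean

/-!
For a reversible chain with transition operator `P`, `n · Var` of the average of `n` consecutive
states is `⟪f, Fₙ(P) f⟫` for the centred `f`, where `Fₙ` is a Fejér mean.  By the uniform
boundedness principle these quantities converge for every `f` exactly when `1 - P` is invertible on
the mean-zero functions, that is, when `P` has a spectral gap; by Cheeger's inequality this happens
exactly when the conductance of `P` is positive.  Conductance only sees the mass that leaves a set,
so it stays positive when `α_MH` is replaced by `α_DA`, provided that, for every `ε > 0`,
`α_DA ≥ c · α_MH` with some `c > 0` outside a set of proposals of mass at most `ε`.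

With `a = log r₁` and `b = log r₂`, `α_MH = exp (min 0 (a + b))` and
`α_DA = exp (min 0 a + min 0 b)`.  Nothing is lost where `a` and `b` agree in sign, and never more
than the factor `exp (-|b|)`, which is bounded below near the origin.  In the tails the change of
`log π'` and `b` agree in sign, so that at most the factor `exp (-|Δ|)` is lost.
-/

section FejerMean

variable {A : Type*}

lemma one_sub_mul_sum_pow_dist [Ring A] (a : A) {i n : ℕ} (hi : i ≤ n) :
    (1 - a) * ∑ j ∈ Finset.range (n + 1), a ^ Nat.dist i j =
      1 + a - (a ^ (i + 1) + a ^ (n + 1 - i)) := by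
  obtain ⟨m, rfl⟩ := Nat.exists_eq_add_of_le hi
  have hleft : ∑ j ∈ Finset.range (i + 1), a ^ Nat.dist i j =
      ∑ k ∈ Finset.range (i + 1), a ^ k := by
    rw [← Finset.sum_range_reflect fun k => a ^ k]
    refine Finset.sum_congr rfl fun j hj => ?_
    rw [Nat.dist_eq_sub_of_le_right (Nat.le_of_lt_succ (Finset.mem_range.1 hj)),
      Nat.add_sub_cancel]
  have hright : ∀ k, a ^ Nat.dist i (i + 1 + k) = a ^ k * a := fun k => by
    rw [Nat.dist_eq_sub_of_le (by omega), ← pow_succ]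
    congr 1
    omega
  rw [show i + m + 1 = i + 1 + m by omega, Finset.sum_range_add, hleft]
  simp only [hright]
  rw [← Finset.sum_mul, mul_add, ← mul_assoc, mul_neg_geom_sum, mul_neg_geom_sum,
    show i + 1 + m - i = m + 1 by omega, sub_mul, one_mul, ← pow_succ]
  abel

/-- The Fejér mean `(n + 1)⁻¹ ∑_{i, j ≤ n} a ^ |i - j|` of the powers of `a`.  For the transition
operator of a stationary reversible chain it gives the variance of `n + 1` consecutive states, and
it is the average of the partial sums of the Neumann series for `(1 + a) / (1 - a)`. -/
noncomputable def fejerMean [Ring A] [Algebra ℝ A] (a : A) (n : ℕ) : A :=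
  ((n + 1 : ℕ) : ℝ)⁻¹ • ∑ i ∈ Finset.range (n + 1), ∑ j ∈ Finset.range (n + 1), a ^ Nat.dist i j

lemma one_sub_sq_mul_fejerMean [Ring A] [Algebra ℝ A] (a : A) (n : ℕ) :
    (1 - a) ^ 2 * fejerMean a n =
      (1 - a) * (1 + a) - ((n + 1 : ℕ) : ℝ)⁻¹ • ((2 : ℝ) • (a - a ^ (n + 2))) := by
  have hpow : (1 - a) * ∑ i ∈ Finset.range (n + 1), a ^ (i + 1) = a - a ^ (n + 2) := by
    rw [Finset.sum_congr rfl fun i _ => pow_succ a i, ← Finset.sum_mul, ← mul_assoc,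
      mul_neg_geom_sum, sub_mul, one_mul, ← pow_succ]
  have hreflect : ∑ i ∈ Finset.range (n + 1), a ^ (n + 1 - i) =
      ∑ i ∈ Finset.range (n + 1), a ^ (i + 1) := by
    rw [← Finset.sum_range_reflect fun i => a ^ (i + 1)]
    refine Finset.sum_congr rfl fun i hi => ?_
    rw [show n + 1 - 1 - i + 1 = n + 1 - i by have := Finset.mem_range.1 hi; omega]
  have hsum : (1 - a) * ∑ i ∈ Finset.range (n + 1), ∑ j ∈ Finset.range (n + 1), a ^ Nat.dist i j =
      ((n + 1 : ℕ) : ℝ) • (1 + a) - (2 : ℝ) • ∑ i ∈ Finset.range (n + 1), a ^ (i + 1) := by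
    rw [Finset.mul_sum, Finset.sum_congr rfl fun i hi =>
        one_sub_mul_sum_pow_dist a (Nat.le_of_lt_succ (Finset.mem_range.1 hi)),
      Finset.sum_sub_distrib, Finset.sum_add_distrib (g := fun i => a ^ (n + 1 - i)), hreflect,
      Finset.sum_const, Finset.card_range, two_smul, Nat.cast_smul_eq_nsmul]
  rw [fejerMean, pow_two, mul_assoc, mul_smul_comm, hsum, smul_sub, smul_smul,
    inv_mul_cancel₀ (by positivity), one_smul, mul_sub, mul_smul_comm, mul_smul_comm, hpow]

theorem exists_tendsto_fejerMean [NormedRing A] [NormedAlgebra ℝ A] {a : A} {C : ℝ}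
    (hpow : ∀ n, ‖a ^ n‖ ≤ C) (hunit : IsUnit (1 - a)) :
    ∃ b, Tendsto (fejerMean a) atTop (𝓝 b) := by
  obtain ⟨u, hu⟩ := hunit.pow 2
  have hfejer : ∀ n, fejerMean a n = ↑u⁻¹ *
      ((1 - a) * (1 + a) - ((n + 1 : ℕ) : ℝ)⁻¹ • ((2 : ℝ) • (a - a ^ (n + 2)))) := fun n => by
    rw [← one_sub_sq_mul_fejerMean, ← hu, Units.inv_mul_cancel_left]
  have hinv : Tendsto (fun n : ℕ => ((n + 1 : ℕ) : ℝ)⁻¹) atTop (𝓝 0) :=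
    (tendsto_inv_atTop_nhds_zero_nat (𝕜 := ℝ)).comp (tendsto_add_atTop_nat 1)
  have hbdd : IsBoundedUnder (· ≤ ·) atTop fun n => ‖(2 : ℝ) • (a - a ^ (n + 2))‖ := by
    refine isBoundedUnder_of ⟨2 * (C + C), fun n => ?_⟩
    rw [norm_smul, Real.norm_ofNat]
    gcongr
    exact (norm_sub_le _ _).trans (add_le_add (by simpa using hpow 1) (hpow _))
  have hlim := (tendsto_const_nhds (x := (1 - a) * (1 + a))).sub
    (hinv.zero_smul_isBoundedUnder_le hbdd)
  exact ⟨_, (hlim.const_mul (↑u⁻¹ : A)).congr fun n => (hfejer n).symm⟩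

end FejerMean

section Contraction

open scoped InnerProductSpace NNReal

variable {H : Type*} [NormedAddCommGroup H] [InnerProductSpace ℝ H]

lemma inner_fejerMean (R : H →L[ℝ] H) (n : ℕ) (x y : H) :
    ⟪x, fejerMean R n y⟫_ℝ = ((n + 1 : ℕ) : ℝ)⁻¹ * ∑ i ∈ Finset.range (n + 1),
      ∑ j ∈ Finset.range (n + 1), ⟪x, (R ^ Nat.dist i j) y⟫_ℝ := by
  simp only [fejerMean, smul_apply, sum_apply, inner_smul_right, inner_sum]

lemma norm_pow_le_one {R : H →L[ℝ] H} (hR : ‖R‖ ≤ 1) : ∀ k, ‖R ^ k‖ ≤ 1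
  | 0 => ContinuousLinearMap.norm_id_le
  | k + 1 => (norm_pow_le' R k.succ_pos).trans (pow_le_one₀ (norm_nonneg R) hR)

lemma norm_pow_apply_le {R : H →L[ℝ] H} (hR : ‖R‖ ≤ 1) (k : ℕ) (x : H) : ‖(R ^ k) x‖ ≤ ‖x‖ := by
  simpa only [one_mul] using (R ^ k).le_of_opNorm_le (norm_pow_le_one hR k) x

lemma norm_sub_pow_apply_le {R : H →L[ℝ] H} (hR : ‖R‖ ≤ 1) (k : ℕ) (x : H) :
    ‖x - (R ^ k) x‖ ≤ k * ‖x - R x‖ := by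
  have hgeom : x - (R ^ k) x = ∑ j ∈ Finset.range k, (R ^ j) (x - R x) := by
    have := congrArg (fun T : H →L[ℝ] H => T x) (geom_sum_mul_neg R k)
    simpa using this.symm
  rw [hgeom]
  refine (norm_sum_le_of_le _ fun j _ => norm_pow_apply_le hR j _).trans ?_
  simp

lemma norm_sub_apply_sq_le {R : H →L[ℝ] H} (hR : ‖R‖ ≤ 1) (x : H) :
    ‖x - R x‖ ^ 2 ≤ 2 * ⟪x, x - R x⟫_ℝ := by
  have hsq : ‖R x‖ ^ 2 ≤ ‖x‖ ^ 2 := by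
    gcongr
    simpa using norm_pow_apply_le hR 1 x
  rw [norm_sub_sq_real, inner_sub_right, real_inner_self_eq_norm_sq]
  linarith

lemma mul_le_inner_fejerMean {R : H →L[ℝ] H} {n : ℕ} {x : H} {b : ℝ}
    (hb : ∀ k ≤ n, b ≤ ⟪x, (R ^ k) x⟫_ℝ) : (n + 1 : ℕ) * b ≤ ⟪x, fejerMean R n x⟫_ℝ := by
  have hterm : ∀ i ∈ Finset.range (n + 1), ∀ j ∈ Finset.range (n + 1),
      b ≤ ⟪x, (R ^ Nat.dist i j) x⟫_ℝ := fun i hi j hj => hb _ <| by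
    rw [Finset.mem_range] at hi hj
    unfold Nat.dist
    omega
  have hsum : (n + 1 : ℕ) * ((n + 1 : ℕ) * b) ≤ ∑ i ∈ Finset.range (n + 1),
      ∑ j ∈ Finset.range (n + 1), ⟪x, (R ^ Nat.dist i j) x⟫_ℝ := by
    have := Finset.sum_le_sum fun i hi => Finset.sum_le_sum (hterm i hi)
    simpa only [Finset.sum_const, Finset.card_range, nsmul_eq_mul] using this
  rw [inner_fejerMean]
  exact (le_inv_mul_iff₀ (by positivity)).2 hsum

variable [CompleteSpace H]

lemma isSelfAdjoint_fejerMean {R : H →L[ℝ] H} (hR : IsSelfAdjoint R) (n : ℕ) :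
    IsSelfAdjoint (fejerMean R n) :=
  .smul (.all _) (isSelfAdjoint_sum _ fun _ _ => isSelfAdjoint_sum _ fun _ _ => hR.pow _)

/-- A pointwise bounded sequence of quadratic forms is uniformly bounded: apply the uniform
boundedness principle twice, after polarization. -/
lemma exists_norm_le_of_quadratic_bounded {F : ℕ → H →L[ℝ] H} (hF : ∀ n, IsSelfAdjoint (F n))
    (hb : ∀ x, ∃ C, ∀ n, |⟪x, F n x⟫_ℝ| ≤ C) : ∃ K, ∀ n, ‖F n‖ ≤ K := by
  have hpolar : ∀ n x y, ⟪F n x, y⟫_ℝ =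
      (⟪x + y, F n (x + y)⟫_ℝ - ⟪x - y, F n (x - y)⟫_ℝ) / 4 := fun n x y => by
    have hsymm : ⟪x, F n y⟫_ℝ = ⟪F n x, y⟫_ℝ := ((hF n).isSymmetric x y).symm
    simp only [map_add, map_sub, inner_add_left, inner_add_right, inner_sub_left, inner_sub_right,
      hsymm, real_inner_comm (F n x) y]
    ring
  have hweak : ∀ x, ∃ K, ∀ n, ‖innerSL ℝ (F n x)‖ ≤ K := fun x => banach_steinhaus fun y => by
    obtain ⟨C, hC⟩ := hb (x + y)
    obtain ⟨C', hC'⟩ := hb (x - y)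
    refine ⟨(C + C') / 4, fun n => ?_⟩
    rw [innerSL_apply_apply, hpolar, Real.norm_eq_abs, abs_div, Nat.abs_ofNat]
    gcongr
    exact (abs_sub _ _).trans (add_le_add (hC n) (hC' n))
  exact banach_steinhaus fun x => by simpa only [innerSL_apply_norm] using hweak x

omit [CompleteSpace H] in
lemma norm_le_of_norm_fejerMean_le {R : H →L[ℝ] H} (hR : ‖R‖ ≤ 1) {n : ℕ}
    (hn : ‖fejerMean R n‖ ≤ n) (x : H) : ‖x‖ ≤ (n + 1) * n * ‖x - R x‖ := by
  have hlower : ∀ k ≤ n, ‖x‖ * (‖x‖ - n * ‖x - R x‖) ≤ ⟪x, (R ^ k) x⟫_ℝ := fun k hk => by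
    have hinner : ⟪x, (R ^ k) x⟫_ℝ = ‖x‖ * ‖x‖ - ⟪x, x - (R ^ k) x⟫_ℝ := by
      rw [inner_sub_right, real_inner_self_eq_norm_mul_norm, sub_sub_cancel]
    rw [hinner, mul_sub]
    gcongr
    refine (real_inner_le_norm _ _).trans ?_
    gcongr
    refine (norm_sub_pow_apply_le hR k x).trans ?_
    gcongr
  have hupper : ⟪x, fejerMean R n x⟫_ℝ ≤ ‖x‖ * (n * ‖x‖) :=
    (real_inner_le_norm _ _).trans (by gcongr; exact (fejerMean R n).le_of_opNorm_le hn x)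
  have hchain := (mul_le_inner_fejerMean hlower).trans hupper
  rcases (norm_nonneg x).eq_or_lt with hx | hx
  · rw [← hx]
    positivity
  · push_cast at hchain
    exact le_of_mul_le_mul_left (by linarith) hx

/-- If the Fejér means of the forms `⟪x, R ^ k x⟫` stay bounded, then `x` cannot be almost fixed by
`R`: otherwise the first `n` terms would all be close to `‖x‖ ^ 2`, and the mean of order `n` to
`n‖x‖ ^ 2`. -/
theorem exists_coercive_of_fejerMean_bounded {R : H →L[ℝ] H} (hsa : IsSelfAdjoint R)
    (hR : ‖R‖ ≤ 1) (hb : ∀ x, ∃ C, ∀ n, |⟪x, fejerMean R n x⟫_ℝ| ≤ C) :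
    ∃ c > 0, ∀ x, c * ‖x‖ ^ 2 ≤ ⟪x, x - R x⟫_ℝ := by
  obtain ⟨K, hK⟩ := exists_norm_le_of_quadratic_bounded (isSelfAdjoint_fejerMean hsa) hb
  obtain ⟨n, hn⟩ := exists_nat_gt (max K 0)
  have hn0 : (0 : ℝ) < n := (le_max_right _ _).trans_lt hn
  refine ⟨1 / (2 * ((n + 1) * n) ^ 2), by positivity, fun x => ?_⟩
  rw [div_mul_eq_mul_div, one_mul, div_le_iff₀ (by positivity)]
  calc ‖x‖ ^ 2 ≤ ((n + 1) * n * ‖x - R x‖) ^ 2 := by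
        gcongr
        exact norm_le_of_norm_fejerMean_le hR ((hK n).trans ((le_max_left _ _).trans hn.le)) x
    _ = ((n + 1) * n) ^ 2 * ‖x - R x‖ ^ 2 := mul_pow _ _ _
    _ ≤ ((n + 1) * n) ^ 2 * (2 * ⟪x, x - R x⟫_ℝ) := by
        gcongr
        exact norm_sub_apply_sq_le hR x
    _ = ⟪x, x - R x⟫_ℝ * (2 * ((n + 1) * n) ^ 2) := by ring

theorem exists_tendsto_inner_fejerMean_of_coercive {R : H →L[ℝ] H} (hR : ‖R‖ ≤ 1) {c : ℝ}
    (hc : 0 < c) (hcoer : ∀ x, c * ‖x‖ ^ 2 ≤ ⟪x, x - R x⟫_ℝ) (x : H) :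
    ∃ v, Tendsto (fun n => ⟪x, fejerMean R n x⟫_ℝ) atTop (𝓝 v) := by
  have hunit : IsUnit (1 - R) :=
    ContinuousLinearMap.isUnit_of_forall_le_norm_inner_map (1 - R) (c := ⟨c, hc.le⟩) hc fun x => by
      rw [real_inner_comm, mul_comm]
      exact (hcoer x).trans (Real.le_norm_self _)
  obtain ⟨T, hT⟩ := exists_tendsto_fejerMean (norm_pow_le_one hR) hunit
  exact ⟨_, tendsto_const_nhds.inner
    (((ContinuousLinearMap.apply ℝ H x).continuous.tendsto T).comp hT)⟩

section Restrict

variable {K : Submodule ℝ H} {R : H →L[ℝ] H}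

omit [CompleteSpace H] in
lemma norm_restrict_le (hK : ∀ x ∈ K, R x ∈ K) : ‖R.restrict hK‖ ≤ ‖R‖ :=
  ContinuousLinearMap.opNorm_le_bound _ (norm_nonneg R) fun x => R.le_opNorm x

omit [CompleteSpace H] in
lemma coe_restrict_pow_apply (hK : ∀ x ∈ K, R x ∈ K) (k : ℕ) (x : K) :
    ((R.restrict hK ^ k) x : H) = (R ^ k) x := by
  induction k with
  | zero => rfl
  | succ k ih =>
    simp only [pow_succ', mul_apply_eq_comp, ContinuousLinearMap.coe_restrict_apply, ih]

omit [CompleteSpace H] in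
lemma inner_fejerMean_restrict (hK : ∀ x ∈ K, R x ∈ K) (n : ℕ) (x : K) :
    ⟪x, fejerMean (R.restrict hK) n x⟫_ℝ = ⟪(x : H), fejerMean R n x⟫_ℝ := by
  rw [inner_fejerMean, inner_fejerMean]
  simp only [Submodule.coe_inner, coe_restrict_pow_apply hK]

theorem exists_coercive_iff_tendsto_fejerMean [CompleteSpace K] (hK : ∀ x ∈ K, R x ∈ K)
    (hsa : IsSelfAdjoint R) (hR : ‖R‖ ≤ 1) :
    (∃ c > 0, ∀ x ∈ K, c * ‖x‖ ^ 2 ≤ ⟪x, x - R x⟫_ℝ) ↔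
      ∀ x ∈ K, ∃ v, Tendsto (fun n => ⟪x, fejerMean R n x⟫_ℝ) atTop (𝓝 v) := by
  have hsaK : IsSelfAdjoint (R.restrict hK) :=
    ContinuousLinearMap.isSelfAdjoint_iff_isSymmetric.2 (hsa.isSymmetric.restrict_invariant hK)
  have hRK : ‖R.restrict hK‖ ≤ 1 := (norm_restrict_le hK).trans hR
  constructor
  · rintro ⟨c, hc, hcoer⟩ x hx
    simpa only [inner_fejerMean_restrict hK] using
      exists_tendsto_inner_fejerMean_of_coercive hRK hc (fun y => hcoer y y.2) ⟨x, hx⟩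
  · intro hlim
    obtain ⟨c, hc, hcoer⟩ := exists_coercive_of_fejerMean_bounded hsaK hRK fun x => by
      obtain ⟨v, hv⟩ := hlim x x.2
      obtain ⟨C, hC⟩ := hv.abs.bddAbove_range
      exact ⟨C, fun n => inner_fejerMean_restrict hK n x ▸ hC ⟨n, rfl⟩⟩
    exact ⟨c, hc, fun x hx => hcoer ⟨x, hx⟩⟩

end Restrict

lemma apply_mem_orthogonal_span_singleton {R : H →L[ℝ] H} (hR : IsSelfAdjoint R) {e : H}
    (he : R e = e) : ∀ x ∈ (ℝ ∙ e)ᗮ, R x ∈ (ℝ ∙ e)ᗮ := fun x hx => by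
  rw [Submodule.mem_orthogonal_singleton_iff_inner_right] at hx ⊢
  have hsymm : ⟪R e, x⟫_ℝ = ⟪e, R x⟫_ℝ := hR.isSymmetric e x
  rw [← hsymm, he, hx]

end Contraction

section MarkovOperator

open scoped InnerProductSpace

variable {S : Type*} [MeasurableSpace S] {P : Kernel S S} [IsMarkovKernel P] {π : Measure S}

lemma integral_comp_of_measurePreserving {T : Type*} [MeasurableSpace T] {μ : Measure S}
    {ν : Measure T} {φ : S → T} (hφ : MeasurePreserving φ μ ν) {g : T → ℝ}
    (hg : AEStronglyMeasurable g ν) : ∫ x, g (φ x) ∂μ = ∫ y, g y ∂ν := by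
  rw [← hφ.map_eq] at hg ⊢
  exact (integral_map hφ.aemeasurable hg).symm

lemma real_inner_L2_eq_integral (f g : Lp ℝ 2 π) : ⟪f, g⟫_ℝ = ∫ x, f x * g x ∂π := by
  rw [L2.inner_def]
  exact integral_congr_ae (.of_forall fun x => mul_comm _ _)

variable [IsProbabilityMeasure π]

lemma compProd_map_swap_of_isReversible (h : P.IsReversible π) :
    (π ⊗ₘ P).map Prod.swap = π ⊗ₘ P := by
  refine Measure.ext_prod fun {s t} hs ht => ?_
  rw [Measure.map_apply measurable_swap (hs.prod ht), Set.preimage_swap_prod,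
    Measure.compProd_apply_prod ht hs, Measure.compProd_apply_prod hs ht, h ht hs]

lemma measurePreserving_fst_compProd {T : Type*} [MeasurableSpace T] {P : Kernel S T}
    [IsMarkovKernel P] : MeasurePreserving Prod.fst (π ⊗ₘ P) π :=
  ⟨measurable_fst, Measure.fst_compProd π P⟩

lemma measurePreserving_snd_compProd (h : P.Invariant π) :
    MeasurePreserving Prod.snd (π ⊗ₘ P) π :=
  ⟨measurable_snd, (Measure.snd_compProd π P).trans h⟩

/-- The transition operator `g ↦ ∫ g(y) P(·, dy)` on `L²(π)` of a Markov kernel with invariant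
distribution `π`.  It is built as the conditional expectation, given the first coordinate, of
functions of the second coordinate under `π(dx) P(x, dy)`. -/
noncomputable def markovOp (h : P.Invariant π) : Lp ℝ 2 π →L[ℝ] Lp ℝ 2 π :=
  (ContinuousLinearMap.adjoint (Lp.compMeasurePreservingₗᵢ ℝ Prod.fst
      (measurePreserving_fst_compProd (P := P) (π := π))).toContinuousLinearMap).comp
    (Lp.compMeasurePreservingₗᵢ ℝ Prod.snd
      (measurePreserving_snd_compProd h)).toContinuousLinearMap

lemma inner_markovOp (h : P.Invariant π) (f g : Lp ℝ 2 π) :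
    ⟪f, markovOp h g⟫_ℝ = ∫ p, f p.1 * g p.2 ∂(π ⊗ₘ P) := by
  rw [markovOp, ContinuousLinearMap.comp_apply, ContinuousLinearMap.adjoint_inner_right,
    real_inner_L2_eq_integral]
  refine integral_congr_ae ?_
  filter_upwards [Lp.coeFn_compMeasurePreserving f (measurePreserving_fst_compProd (P := P)),
    Lp.coeFn_compMeasurePreserving g (measurePreserving_snd_compProd h)] with p hf hg
  exact congrArg₂ (· * ·) hf hg

lemma norm_markovOp_le_one (h : P.Invariant π) : ‖markovOp h‖ ≤ 1 := by
  refine (ContinuousLinearMap.opNorm_comp_le _ _).trans (mul_le_one₀ ?_ (norm_nonneg _) ?_)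
  · rw [ContinuousLinearMap.adjoint.norm_map]
    exact LinearIsometry.norm_toContinuousLinearMap_le _
  · exact LinearIsometry.norm_toContinuousLinearMap_le _

lemma isSelfAdjoint_markovOp (h : P.IsReversible π) : IsSelfAdjoint (markovOp h.invariant) := by
  refine ContinuousLinearMap.isSelfAdjoint_iff_isSymmetric.2 fun f g => ?_
  rw [ContinuousLinearMap.coe_coe, real_inner_comm, inner_markovOp, inner_markovOp]
  conv_lhs => rw [← compProd_map_swap_of_isReversible h]
  refine (integral_map_equiv MeasurableEquiv.prodComm (fun p : S × S => g p.1 * f p.2)).trans ?_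
  exact integral_congr_ae (.of_forall fun p => mul_comm _ _)

lemma markovOp_ae_eq (h : P.Invariant π) (g : Lp ℝ 2 π) :
    markovOp h g =ᵐ[π] fun x => ∫ y, g y ∂(P x) := by
  have hsnd : Integrable (fun p : S × S => g p.2) (π ⊗ₘ P) :=
    ((Lp.memLp g).comp_measurePreserving (measurePreserving_snd_compProd h)).integrable
      one_le_two
  refine Integrable.ae_eq_of_forall_setIntegral_eq _ _ ((Lp.memLp _).integrable one_le_two)
    hsnd.integral_compProd fun s hs _ => ?_
  have hindicator : ∀ᵐ p ∂(π ⊗ₘ P), indicatorConstLp 2 hs (measure_ne_top π s) (1 : ℝ) p.1 * g p.2 =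
      (s ×ˢ Set.univ).indicator (fun p => g p.2) p := by
    filter_upwards [measurePreserving_fst_compProd.quasiMeasurePreserving.ae_eq_comp
      (indicatorConstLp_coeFn (p := 2) (hs := hs) (hμs := measure_ne_top π s) (c := (1 : ℝ)))]
      with p hp
    rw [Function.comp_apply, Function.comp_apply] at hp
    by_cases hps : p.1 ∈ s <;> simp [hp, Set.indicator, hps]
  calc ∫ x in s, markovOp h g x ∂π
      = ⟪indicatorConstLp 2 hs (measure_ne_top π s) (1 : ℝ), markovOp h g⟫_ℝ :=
        (L2.inner_indicatorConstLp_one hs (measure_ne_top π s) _).symm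
    _ = ∫ p in s ×ˢ Set.univ, g p.2 ∂(π ⊗ₘ P) := by
        rw [inner_markovOp, integral_congr_ae hindicator,
          integral_indicator (hs.prod MeasurableSet.univ)]
    _ = ∫ x in s, ∫ y, g y ∂(P x) ∂π := by
        rw [Measure.setIntegral_compProd hs MeasurableSet.univ hsnd.integrableOn]
        simp only [setIntegral_univ]

/-- The constant function `1` in `L²(π)`. -/
noncomputable def oneL2 (π : Measure S) [IsProbabilityMeasure π] : Lp ℝ 2 π :=
  Lp.const 2 π (1 : ℝ)

lemma oneL2_ae_eq : oneL2 π =ᵐ[π] fun _ => 1 := Lp.coeFn_const 2 π 1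

lemma inner_oneL2 (f : Lp ℝ 2 π) : ⟪oneL2 π, f⟫_ℝ = ∫ x, f x ∂π := by
  rw [real_inner_L2_eq_integral]
  refine integral_congr_ae ?_
  filter_upwards [oneL2_ae_eq (π := π)] with x hx
  rw [hx, one_mul]

lemma markovOp_oneL2 (h : P.Invariant π) : markovOp h (oneL2 π) = oneL2 π := by
  refine Lp.ext ?_
  have hstep := Measure.ae_ae_of_ae_compProd
    ((measurePreserving_snd_compProd h).quasiMeasurePreserving.ae oneL2_ae_eq)
  filter_upwards [markovOp_ae_eq h (oneL2 π), oneL2_ae_eq (π := π), hstep] with x hx hone hPx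
  rw [hx, hone, integral_congr_ae hPx]
  simp

end MarkovOperator

section PathLaw

open scoped InnerProductSpace

variable {S : Type*} [MeasurableSpace S]

lemma measurable_snoc (n : ℕ) : Measurable
    (fun p : (Fin (n + 1) → S) × S => Fin.snoc (α := fun _ => S) p.1 p.2) := by
  refine measurable_pi_iff.2 fun i => ?_
  induction i using Fin.lastCases with
  | last => simpa only [Fin.snoc_last] using measurable_snd
  | cast i => simpa only [Fin.snoc_castSucc, Function.comp_def] using
      (measurable_pi_apply i).comp measurable_fst

variable {P : Kernel S S} [IsMarkovKernel P] {π : Measure S} [IsProbabilityMeasure π]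

instance isProbabilityMeasure_pathLaw (n : ℕ) : IsProbabilityMeasure (pathLaw P π n) := by
  induction n with
  | zero => exact Measure.isProbabilityMeasure_map (by fun_prop)
  | succ n ih => exact Measure.isProbabilityMeasure_map (measurable_snoc n).aemeasurable

lemma measurePreserving_init_pathLaw (n : ℕ) :
    MeasurePreserving (fun (x : Fin (n + 2) → S) i => x (Fin.castSucc i))
      (pathLaw P π (n + 1)) (pathLaw P π n) := by
  have hm : Measurable fun (x : Fin (n + 2) → S) (i : Fin (n + 1)) => x i.castSucc := by fun_prop
  refine ⟨hm, ?_⟩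
  rw [pathLaw, Measure.map_map hm (measurable_snoc n)]
  simp only [Function.comp_def, Fin.snoc_castSucc]
  exact Measure.fst_compProd (pathLaw P π n) _

lemma map_last_pathLaw_succ (n : ℕ) :
    (pathLaw P π (n + 1)).map (fun x => x (Fin.last (n + 1))) =
      P ∘ₘ (pathLaw P π n).map (fun x => x (Fin.last n)) := by
  have hm : Measurable fun x : Fin (n + 1) → S => x (Fin.last n) := measurable_pi_apply _
  rw [← Measure.deterministic_comp_eq_map hm, Measure.comp_assoc,
    Kernel.comp_deterministic_eq_comap, ← Measure.snd_compProd, pathLaw,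
    Measure.map_map (measurable_pi_apply _) (measurable_snoc n)]
  simp only [Function.comp_def, Fin.snoc_last]
  rfl

lemma measurePreserving_eval_pathLaw (h : P.Invariant π) (n : ℕ) (i : Fin (n + 1)) :
    MeasurePreserving (fun x : Fin (n + 1) → S => x i) (pathLaw P π n) π := by
  induction n with
  | zero =>
    refine ⟨measurable_pi_apply _, ?_⟩
    rw [pathLaw, Measure.map_map (measurable_pi_apply _) (by fun_prop)]
    exact Measure.map_id
  | succ n ih =>
    induction i using Fin.lastCases with
    | last => exact ⟨measurable_pi_apply _, by rw [map_last_pathLaw_succ, (ih _).map_eq, h]⟩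
    | cast i => exact (ih i).comp (measurePreserving_init_pathLaw n)

lemma integral_eval_pathLaw (h : P.Invariant π) {n : ℕ} (i : Fin (n + 1)) {f : S → ℝ}
    (hf : AEStronglyMeasurable f π) : ∫ x, f (x i) ∂(pathLaw P π n) = ∫ x, f x ∂π :=
  integral_comp_of_measurePreserving (measurePreserving_eval_pathLaw h n i) hf

lemma memLp_eval_pathLaw (h : P.Invariant π) {n : ℕ} (i : Fin (n + 1)) {f : S → ℝ}
    (hf : MemLp f 2 π) : MemLp (fun x => f (x i)) 2 (pathLaw P π n) :=
  hf.comp_measurePreserving (measurePreserving_eval_pathLaw h n i)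

lemma integral_mul_eval_last_pathLaw (h : P.Invariant π) {n : ℕ} {F : (Fin (n + 1) → S) → ℝ}
    (hF : MemLp F 2 (pathLaw P π n)) (g : Lp ℝ 2 π) :
    ∫ x, F (fun i => x (Fin.castSucc i)) * g (x (Fin.last (n + 1))) ∂(pathLaw P π (n + 1)) =
      ∫ x, F x * markovOp h g (x (Fin.last n)) ∂(pathLaw P π n) := by
  have hint : Integrable (fun x : Fin (n + 2) → S =>
      F (fun i => x (Fin.castSucc i)) * g (x (Fin.last (n + 1)))) (pathLaw P π (n + 1)) :=
    (hF.comp_measurePreserving (measurePreserving_init_pathLaw n)).integrable_mul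
      (memLp_eval_pathLaw h (Fin.last (n + 1)) (Lp.memLp g))
  have hsnoc : MeasurePreserving
      (fun p : (Fin (n + 1) → S) × S => Fin.snoc (α := fun _ => S) p.1 p.2)
      (pathLaw P π n ⊗ₘ P.comap (fun x => x (Fin.last n)) (measurable_pi_apply _))
      (pathLaw P π (n + 1)) := ⟨measurable_snoc n, rfl⟩
  have hint' := hsnoc.integrable_comp_of_integrable hint
  rw [← integral_comp_of_measurePreserving hsnoc hint.aestronglyMeasurable]
  simp only [Function.comp_def, Fin.snoc_castSucc, Fin.snoc_last] at hint' ⊢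
  rw [Measure.integral_compProd hint']
  refine integral_congr_ae ?_
  have hlast := measurePreserving_eval_pathLaw h n (Fin.last n)
  filter_upwards [hlast.quasiMeasurePreserving.ae_eq_comp (markovOp_ae_eq h g)] with x hx
  rw [integral_const_mul]
  exact congrArg (F x * ·) hx.symm

lemma integral_eval_mul_eval_pathLaw_of_le (h : P.Invariant π) (f g : Lp ℝ 2 π) {n : ℕ}
    {i j : Fin (n + 1)} (hij : i ≤ j) :
    ∫ x, f (x i) * g (x j) ∂(pathLaw P π n) = ⟪f, (markovOp h ^ (j - i : ℕ)) g⟫_ℝ := by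
  have hdiag : ∀ (g : Lp ℝ 2 π) {n : ℕ} (i : Fin (n + 1)),
      ∫ x, f (x i) * g (x i) ∂(pathLaw P π n) = ⟪f, (markovOp h ^ (i - i : ℕ)) g⟫_ℝ := by
    intro g n i
    rw [integral_eval_pathLaw h i (f := fun x => f x * g x)
      ((Lp.aestronglyMeasurable f).mul (Lp.aestronglyMeasurable g)),
      Nat.sub_self, pow_zero, one_apply_eq_self, real_inner_L2_eq_integral]
  induction n generalizing g with
  | zero => rw [Subsingleton.elim (α := Fin 1) j i]; exact hdiag g i
  | succ n ih =>
    induction i using Fin.lastCases with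
    | last => rw [Fin.last_le_iff.1 hij]; exact hdiag g _
    | cast i =>
      induction j using Fin.lastCases with
      | last =>
        have hpow : ((Fin.last (n + 1) : ℕ) - (Fin.castSucc i : ℕ)) = (Fin.last n : ℕ) - i + 1 := by
          simp only [Fin.val_last, Fin.val_castSucc]
          omega
        rw [hpow, pow_succ, mul_apply_eq_comp, ← ih _ (Fin.le_last i)]
        exact integral_mul_eval_last_pathLaw h (memLp_eval_pathLaw h i (Lp.memLp f)) g
      | cast j =>
        rw [Fin.val_castSucc, Fin.val_castSucc, ← ih g (Fin.castSucc_le_castSucc_iff.1 hij)]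
        exact integral_comp_of_measurePreserving (measurePreserving_init_pathLaw n)
          (g := fun x => f (x i) * g (x j))
          ((memLp_eval_pathLaw h i (Lp.memLp f)).aestronglyMeasurable.mul
            (memLp_eval_pathLaw h j (Lp.memLp g)).aestronglyMeasurable)

lemma integral_eval_mul_eval_pathLaw (h : P.IsReversible π) (f : Lp ℝ 2 π) {n : ℕ}
    (i j : Fin (n + 1)) : ∫ x, f (x i) * f (x j) ∂(pathLaw P π n) =
      ⟪f, (markovOp h.invariant ^ Nat.dist i j) f⟫_ℝ := by
  rcases le_total i j with hij | hji
  · rw [integral_eval_mul_eval_pathLaw_of_le h.invariant f f hij, Nat.dist_eq_sub_of_le hij]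
  · refine (integral_congr_ae (.of_forall fun x : Fin (n + 1) → S =>
      mul_comm (f (x i)) (f (x j)))).trans ?_
    rw [integral_eval_mul_eval_pathLaw_of_le h.invariant f f hji, Nat.dist_comm,
      Nat.dist_eq_sub_of_le hji]

lemma variance_sum_pathLaw (h : P.IsReversible π) (f : Lp ℝ 2 π) (hf : ∫ x, f x ∂π = 0) (n : ℕ) :
    Var[fun x : Fin (n + 1) → S => ∑ i, f (x i); pathLaw P π n] =
      ((n + 1 : ℕ) : ℝ) * ⟪f, fejerMean (markovOp h.invariant) n f⟫_ℝ := by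
  have hL := fun i : Fin (n + 1) => memLp_eval_pathLaw h.invariant i (Lp.memLp f)
  have hcov : ∀ i j : Fin (n + 1), cov[fun x => f (x i), fun x => f (x j); pathLaw P π n] =
      ⟪f, (markovOp h.invariant ^ Nat.dist i j) f⟫_ℝ := by
    intro i j
    rw [covariance_eq_sub (hL i) (hL j),
      integral_eval_pathLaw h.invariant i (Lp.aestronglyMeasurable f), hf, zero_mul, sub_zero]
    exact integral_eval_mul_eval_pathLaw h f i j
  rw [variance_fun_sum hL, inner_fejerMean, mul_inv_cancel_left₀ (by positivity)]
  simp only [hcov, Finset.sum_range]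

lemma mem_orthogonal_span_oneL2 {f : Lp ℝ 2 π} : f ∈ (ℝ ∙ oneL2 π)ᗮ ↔ ∫ x, f x ∂π = 0 := by
  rw [Submodule.mem_orthogonal_singleton_iff_inner_right, inner_oneL2]

theorem mul_evariance_average_pathLaw (h : P.IsReversible π) {f : S → ℝ} {f₀ : Lp ℝ 2 π}
    (hf₀ : f₀ ∈ (ℝ ∙ oneL2 π)ᗮ) {m : ℝ} (hf : f =ᵐ[π] fun x => f₀ x + m) (n : ℕ) :
    ((n + 1 : ℕ) : ℝ≥0∞) *
      evariance (fun x : Fin (n + 1) → S => (∑ i, f (x i)) / ((n + 1 : ℕ) : ℝ)) (pathLaw P π n) =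
    ENNReal.ofReal ⟪f₀, fejerMean (markovOp h.invariant) n f₀⟫_ℝ := by
  have hn : ((n + 1 : ℕ) : ℝ) ≠ 0 := by positivity
  have hL : MemLp (fun x : Fin (n + 1) → S => ((n + 1 : ℕ) : ℝ)⁻¹ * ∑ i, f₀ (x i)) 2
      (pathLaw P π n) :=
    (memLp_finsetSum _ fun i _ => memLp_eval_pathLaw h.invariant i (Lp.memLp f₀)).const_mul _
  have hLm : MemLp (fun x : Fin (n + 1) → S => ((n + 1 : ℕ) : ℝ)⁻¹ * ∑ i, f₀ (x i) + m) 2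
      (pathLaw P π n) := hL.add (memLp_const m)
  have hcentre : (fun x : Fin (n + 1) → S => (∑ i, f (x i)) / ((n + 1 : ℕ) : ℝ)) =ᵐ[pathLaw P π n]
      fun x => ((n + 1 : ℕ) : ℝ)⁻¹ * ∑ i, f₀ (x i) + m := by
    have hall : ∀ᵐ x ∂(pathLaw P π n), ∀ i, f (x i) = f₀ (x i) + m := ae_all_iff.2 fun i =>
      (measurePreserving_eval_pathLaw h.invariant n i).quasiMeasurePreserving.ae hf
    filter_upwards [hall] with x hx
    simp only [hx, Finset.sum_add_distrib, Finset.sum_const, Finset.card_univ, Fintype.card_fin,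
      nsmul_eq_mul, div_eq_inv_mul, mul_add, inv_mul_cancel_left₀ hn]
  rw [evariance_congr hcentre, ← ofReal_variance hLm,
    variance_add_const hL.aestronglyMeasurable, variance_const_mul,
    variance_sum_pathLaw h f₀ (mem_orthogonal_span_oneL2.1 hf₀),
    ← ENNReal.ofReal_natCast, ← ENNReal.ofReal_mul (Nat.cast_nonneg _)]
  congr 1
  field_simp

end PathLaw

section SpectralGap

open scoped InnerProductSpace

variable {S : Type*} [MeasurableSpace S] {P : Kernel S S} [IsMarkovKernel P] {π : Measure S}
  [IsProbabilityMeasure π]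

/-- The Poincaré inequality `c Var(f) ≤ ∬ (f(x) - f(y))² π(dx) P(x, dy)` for all `f ∈ L²(π)`.  For
a reversible kernel, it says that the spectrum of the transition operator on the mean-zero functions
of `L²(π)` stays away from `1`. -/
def HasSpectralGap (P : Kernel S S) (π : Measure S) : Prop :=
  ∃ c : ℝ, 0 < c ∧ ∀ f : S → ℝ, Measurable f → MemLp f 2 π →
    c * Var[f; π] ≤ ∫ p, (f p.1 - f p.2) ^ 2 ∂(π ⊗ₘ P)

lemma integral_sq_sub_compProd (h : P.Invariant π) (f : Lp ℝ 2 π) :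
    ∫ p, (f p.1 - f p.2) ^ 2 ∂(π ⊗ₘ P) = 2 * ⟪f, f - markovOp h f⟫_ℝ := by
  have hfst := measurePreserving_fst_compProd (P := P) (π := π)
  have hsnd := measurePreserving_snd_compProd h
  have hsq := (Lp.memLp f).integrable_sq
  have hsq₁ : Integrable (fun p : S × S => f p.1 ^ 2) (π ⊗ₘ P) :=
    hfst.integrable_comp_of_integrable hsq
  have hsq₂ : Integrable (fun p : S × S => f p.2 ^ 2) (π ⊗ₘ P) :=
    hsnd.integrable_comp_of_integrable hsq
  have hmul : Integrable (fun p : S × S => f p.1 * f p.2) (π ⊗ₘ P) :=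
    ((Lp.memLp f).comp_measurePreserving hfst).integrable_mul
      ((Lp.memLp f).comp_measurePreserving hsnd)
  have hexpand : ∀ p : S × S, (f p.1 - f p.2) ^ 2 = f p.1 ^ 2 + f p.2 ^ 2 - 2 * (f p.1 * f p.2) :=
    fun p => by ring
  simp only [hexpand]
  rw [integral_sub (f := fun p : S × S => f p.1 ^ 2 + f p.2 ^ 2) (hsq₁.add hsq₂) (hmul.const_mul 2),
    integral_add hsq₁ hsq₂, integral_const_mul,
    integral_comp_of_measurePreserving hfst (g := fun x => f x ^ 2) hsq.1,
    integral_comp_of_measurePreserving hsnd (g := fun x => f x ^ 2) hsq.1,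
    inner_sub_right, inner_markovOp, real_inner_L2_eq_integral]
  simp only [pow_two]
  ring

lemma variance_eq_norm_sq {f : Lp ℝ 2 π} (hf : f ∈ (ℝ ∙ oneL2 π)ᗮ) : Var[f; π] = ‖f‖ ^ 2 := by
  rw [variance_of_integral_eq_zero (Lp.aestronglyMeasurable f).aemeasurable
    (mem_orthogonal_span_oneL2.1 hf), ← real_inner_self_eq_norm_sq, real_inner_L2_eq_integral]
  simp only [pow_two]

lemma exists_ae_eq_add_const {f : S → ℝ} (hf : MemLp f 2 π) :
    ∃ f₀ ∈ (ℝ ∙ oneL2 π)ᗮ, ∃ m, f =ᵐ[π] fun x => f₀ x + m := by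
  have hcentred : MemLp (fun x => f x - ∫ y, f y ∂π) 2 π := hf.sub (memLp_const _)
  refine ⟨hcentred.toLp, mem_orthogonal_span_oneL2.2 ?_, ∫ y, f y ∂π, ?_⟩
  · rw [integral_congr_ae hcentred.coeFn_toLp,
      integral_sub (hf.integrable one_le_two) (integrable_const _)]
    simp
  · filter_upwards [hcentred.coeFn_toLp] with x hx
    rw [hx, sub_add_cancel]

lemma hasSpectralGap_iff_coercive (h : P.Invariant π) : HasSpectralGap P π ↔
    ∃ c > 0, ∀ f ∈ (ℝ ∙ oneL2 π)ᗮ, c * ‖f‖ ^ 2 ≤ ⟪f, f - markovOp h f⟫_ℝ := by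
  constructor
  · rintro ⟨c, hc, hgap⟩
    refine ⟨c / 2, half_pos hc, fun f hf => ?_⟩
    have hgapf := hgap f (Lp.stronglyMeasurable f).measurable (Lp.memLp f)
    rw [integral_sq_sub_compProd h, variance_eq_norm_sq hf] at hgapf
    linarith
  · rintro ⟨c, hc, hcoer⟩
    refine ⟨2 * c, by positivity, fun f _ hf => ?_⟩
    obtain ⟨f₀, hf₀, m, hfm⟩ := exists_ae_eq_add_const hf
    have hform : ∫ p, (f p.1 - f p.2) ^ 2 ∂(π ⊗ₘ P) = ∫ p, (f₀ p.1 - f₀ p.2) ^ 2 ∂(π ⊗ₘ P) := by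
      refine integral_congr_ae ?_
      filter_upwards [measurePreserving_fst_compProd.quasiMeasurePreserving.ae hfm,
        (measurePreserving_snd_compProd h).quasiMeasurePreserving.ae hfm] with p hfst hsnd
      rw [hfst, hsnd, add_sub_add_right_eq_sub]
    rw [variance_congr hfm, variance_add_const (Lp.aestronglyMeasurable f₀),
      variance_eq_norm_sq hf₀, hform, integral_sq_sub_compProd h]
    linarith [hcoer f₀ hf₀]

lemma isVarianceBounding_iff_tendsto_fejerMean (h : P.IsReversible π) : IsVarianceBounding P π ↔
    ∀ f ∈ (ℝ ∙ oneL2 π)ᗮ, ∃ v, Tendsto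
      (fun n => ⟪f, fejerMean (markovOp h.invariant) n f⟫_ℝ) atTop (𝓝 v) := by
  constructor
  · intro hvb f hf
    have hnonneg : ∀ n, 0 ≤ ⟪f, fejerMean (markovOp h.invariant) n f⟫_ℝ := fun n => by
      have hvar := variance_nonneg (fun x : Fin (n + 1) → S => ∑ i, f (x i)) (pathLaw P π n)
      rw [variance_sum_pathLaw h f (mem_orthogonal_span_oneL2.1 hf)] at hvar
      exact nonneg_of_mul_nonneg_right hvar (by positivity)
    obtain ⟨v, hv, hlim⟩ := hvb f (Lp.memLp f)
    refine ⟨v.toReal, ((ENNReal.tendsto_toReal hv.ne).comp hlim).congr fun n => ?_⟩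
    rw [Function.comp_apply, mul_evariance_average_pathLaw h hf (m := 0) (by simp),
      ENNReal.toReal_ofReal (hnonneg n)]
  · intro hlim f hf
    obtain ⟨f₀, hf₀, m, hfm⟩ := exists_ae_eq_add_const hf
    obtain ⟨v, hv⟩ := hlim f₀ hf₀
    exact ⟨ENNReal.ofReal v, ENNReal.ofReal_lt_top, (ENNReal.tendsto_ofReal hv).congr fun n =>
      (mul_evariance_average_pathLaw h hf₀ hfm n).symm⟩

theorem isVarianceBounding_iff_hasSpectralGap (h : P.IsReversible π) :
    IsVarianceBounding P π ↔ HasSpectralGap P π := by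
  rw [isVarianceBounding_iff_tendsto_fejerMean h, hasSpectralGap_iff_coercive h.invariant]
  exact (exists_coercive_iff_tendsto_fejerMean
    (apply_mem_orthogonal_span_singleton (isSelfAdjoint_markovOp h) (markovOp_oneL2 h.invariant))
    (isSelfAdjoint_markovOp h) (norm_markovOp_le_one h.invariant)).symm

end SpectralGap

section Cheeger

open scoped NNReal

lemma exists_measure_Ioi_le_half (ν : Measure ℝ) [IsProbabilityMeasure ν] :
    ∃ m, ν (Set.Ioi m) ≤ 1 / 2 ∧ ν (Set.Iio m) ≤ 1 / 2 := by
  set T := {t | 1 / 2 ≤ ν (Set.Iic t)}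
  have hhalf : (1 / 2 : ℝ≥0∞) < ν Set.univ := by simp
  have hnonempty : T.Nonempty :=
    ((tendsto_measure_Iic_atTop ν).eventually_const_le hhalf).exists
  have hbdd : BddBelow T := by
    obtain ⟨b, hb⟩ := ((tendsto_measure_Ici_atBot ν).eventually_const_lt hhalf).exists
    refine ⟨b, fun t (ht : 1 / 2 ≤ ν (Set.Iic t)) => not_lt.1 fun htb => ?_⟩
    have hunion := measure_union (μ := ν) (Set.Iic_disjoint_Ici.2 htb.not_ge) measurableSet_Ici
    refine (ENNReal.add_lt_add_of_le_of_lt (by simp) ht hb).not_ge ?_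
    rw [ENNReal.add_halves, ← hunion]
    exact prob_le_one
  refine ⟨sInf T, ?_, ?_⟩
  · rw [isOpen_Ioi.measure_eq_iSup_isCompact]
    refine iSup₂_le fun K hK => iSup_le fun hKc => ?_
    obtain rfl | hKne := K.eq_empty_or_nonempty
    · simp
    obtain ⟨k, hk, hkmin⟩ := hKc.exists_isLeast hKne
    obtain ⟨t, ht, htk⟩ := exists_lt_of_csInf_lt hnonempty (hK hk)
    calc ν K ≤ ν (Set.Iic t)ᶜ := measure_mono fun x hx => not_le.2 (htk.trans_le (hkmin hx))
      _ ≤ 1 - 1 / 2 := (prob_compl_eq_one_sub measurableSet_Iic).trans_le (tsub_le_tsub_left ht 1)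
      _ = 1 / 2 := ENNReal.sub_half ENNReal.one_ne_top
  · rw [isOpen_Iio.measure_eq_iSup_isCompact]
    refine iSup₂_le fun K hK => iSup_le fun hKc => ?_
    obtain rfl | hKne := K.eq_empty_or_nonempty
    · simp
    obtain ⟨k, hk, hkmax⟩ := hKc.exists_isGreatest hKne
    have hkT : k ∉ T := fun hkT => (csInf_le hbdd hkT).not_gt (hK hk)
    exact (measure_mono fun x hx => hkmax hx).trans (not_le.1 hkT).le

variable {S : Type*} [MeasurableSpace S]

lemma exists_median (π : Measure S) [IsProbabilityMeasure π] {f : S → ℝ} (hf : Measurable f) :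
    ∃ m, π {x | m < f x} ≤ 1 / 2 ∧ π {x | f x < m} ≤ 1 / 2 := by
  have := Measure.isProbabilityMeasure_map (μ := π) hf.aemeasurable
  obtain ⟨m, hIoi, hIio⟩ := exists_measure_Ioi_le_half (π.map f)
  rw [Measure.map_apply hf measurableSet_Ioi] at hIoi
  rw [Measure.map_apply hf measurableSet_Iio] at hIio
  exact ⟨m, hIoi, hIio⟩

/-- A kernel has positive conductance if the stationary flow out of each set of mass at most `1/2`
is at least a fixed fraction of the mass of the set. -/
def HasPositiveConductance (P : Kernel S S) (π : Measure S) : Prop :=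
  ∃ κ : ℝ≥0, 0 < κ ∧ ∀ A, MeasurableSet A → π A ≤ 1 / 2 → κ * π A ≤ ∫⁻ x in A, P x Aᶜ ∂π

variable {P : Kernel S S} [IsMarkovKernel P] {π : Measure S} [IsProbabilityMeasure π]

lemma compProd_prod_self_add_flow {A : Set S} (hA : MeasurableSet A) :
    (π ⊗ₘ P) (A ×ˢ A) + ∫⁻ x in A, P x Aᶜ ∂π = π A := by
  rw [Measure.compProd_apply_prod hA hA, ← lintegral_add_left (P.measurable_coe hA)]
  simp [measure_add_measure_compl hA]

lemma sq_max_zero_add_sq_max_neg_zero (a : ℝ) : max a 0 ^ 2 + max (-a) 0 ^ 2 = a ^ 2 := by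
  rcases le_total a 0 with ha | ha <;> simp [ha]

lemma sq_max_zero_sub_add_sq_max_neg_zero_sub_le (a b : ℝ) :
    (max a 0 - max b 0) ^ 2 + (max (-a) 0 - max (-b) 0) ^ 2 ≤ (a - b) ^ 2 := by
  rcases le_total a 0 with ha | ha <;> rcases le_total b 0 with hb | hb <;>
    simp only [max_eq_left, max_eq_right, neg_nonneg, neg_nonpos, ha, hb] <;>
    nlinarith

section Poincare

variable {κ : ℝ≥0}
  (hκ : ∀ A, MeasurableSet A → π A ≤ 1 / 2 → κ * π A ≤ ∫⁻ x in A, P x Aᶜ ∂π)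

include hκ

/-- The conductance bound, integrated over the superlevel sets of `u`. -/
lemma lintegral_min_add_le {u : S → ℝ} (hu : Measurable u) (hu0 : 0 ≤ u)
    (hsupp : π {x | u x ≠ 0} ≤ 1 / 2) :
    ∫⁻ p, ENNReal.ofReal (min (u p.1) (u p.2)) ∂(π ⊗ₘ P) + κ * ∫⁻ x, ENNReal.ofReal (u x) ∂π ≤
      ∫⁻ x, ENNReal.ofReal (u x) ∂π := by
  have hlevel : ∀ t, MeasurableSet {x | t < u x} := fun t => measurableSet_lt measurable_const hu
  have hanti : Antitone fun t => π {x | t < u x} := fun s t hst =>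
    measure_mono fun x (hx : t < u x) => hst.trans_lt hx
  have hmin : Measurable fun p : S × S => min (u p.1) (u p.2) := by fun_prop
  rw [lintegral_eq_lintegral_meas_lt (π ⊗ₘ P) (f := fun p => min (u p.1) (u p.2))
      (.of_forall fun p => le_min (hu0 _) (hu0 _)) hmin.aemeasurable,
    lintegral_eq_lintegral_meas_lt _ (.of_forall hu0) hu.aemeasurable,
    ← lintegral_const_mul _ hanti.measurable,
    ← lintegral_add_right _ (hanti.measurable.const_mul _)]
  refine setLIntegral_mono hanti.measurable fun t ht => ?_
  have hprod : {p : S × S | t < min (u p.1) (u p.2)} = {x | t < u x} ×ˢ {x | t < u x} := by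
    ext p
    simp
  have hhalf : π {x | t < u x} ≤ 1 / 2 :=
    (measure_mono fun x hx => ((Set.mem_Ioi.1 ht).trans hx).ne').trans hsupp
  calc (π ⊗ₘ P) {p : S × S | t < min (u p.1) (u p.2)} + κ * π {x | t < u x}
      ≤ (π ⊗ₘ P) ({x | t < u x} ×ˢ {x | t < u x}) + ∫⁻ x in {x | t < u x}, P x {x | t < u x}ᶜ ∂π :=
        add_le_add (by rw [hprod]) (hκ _ (hlevel t) hhalf)
    _ = π {x | t < u x} := compProd_prod_self_add_flow (hlevel t)

lemma mul_integral_le_integral_abs_sub (h : P.Invariant π) {u : S → ℝ} (hu : Measurable u)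
    (hu0 : 0 ≤ u) (hui : Integrable u π) (hsupp : π {x | u x ≠ 0} ≤ 1 / 2) :
    2 * κ * ∫ x, u x ∂π ≤ ∫ p, |u p.1 - u p.2| ∂(π ⊗ₘ P) := by
  have hfst := measurePreserving_fst_compProd (P := P) (π := π)
  have hsnd := measurePreserving_snd_compProd h
  have hu₁ : Integrable (fun p : S × S => u p.1) (π ⊗ₘ P) := hfst.integrable_comp_of_integrable hui
  have hu₂ : Integrable (fun p : S × S => u p.2) (π ⊗ₘ P) := hsnd.integrable_comp_of_integrable hui
  have hmin : Integrable (fun p : S × S => min (u p.1) (u p.2)) (π ⊗ₘ P) := hu₁.inf hu₂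
  have hmin0 : 0 ≤ fun p : S × S => min (u p.1) (u p.2) := fun p => le_min (hu0 _) (hu0 _)
  have hreal : ∫ p, min (u p.1) (u p.2) ∂(π ⊗ₘ P) + κ * ∫ x, u x ∂π ≤ ∫ x, u x ∂π := by
    have hlevels := lintegral_min_add_le hκ hu hu0 hsupp
    rw [← ofReal_integral_eq_lintegral_ofReal hmin (.of_forall hmin0),
      ← ofReal_integral_eq_lintegral_ofReal hui (.of_forall hu0), ← ENNReal.ofReal_coe_nnreal,
      ← ENNReal.ofReal_mul (NNReal.coe_nonneg κ), ← ENNReal.ofReal_add (integral_nonneg hmin0)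
        (mul_nonneg (NNReal.coe_nonneg κ) (integral_nonneg hu0))] at hlevels
    exact (ENNReal.ofReal_le_ofReal_iff (integral_nonneg hu0)).1 hlevels
  have habs : ∀ p : S × S, |u p.1 - u p.2| = u p.1 + u p.2 - 2 * min (u p.1) (u p.2) := fun p => by
    linarith [max_sub_min_eq_abs (u p.1) (u p.2), min_add_max (u p.1) (u p.2),
      abs_sub_comm (u p.1) (u p.2)]
  simp only [habs]
  rw [integral_sub (f := fun p : S × S => u p.1 + u p.2) (hu₁.add hu₂) (hmin.const_mul 2),
    integral_add hu₁ hu₂, integral_const_mul,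
    integral_comp_of_measurePreserving hfst hui.1, integral_comp_of_measurePreserving hsnd hui.1]
  linarith

lemma sq_mul_integral_sq_le (h : P.Invariant π) {g : S → ℝ} (hgm : Measurable g)
    (hg : MemLp g 2 π) (hsupp : π {x | g x ≠ 0} ≤ 1 / 2) :
    κ ^ 2 * ∫ x, g x ^ 2 ∂π ≤ ∫ p, (g p.1 - g p.2) ^ 2 ∂(π ⊗ₘ P) := by
  have hfst := measurePreserving_fst_compProd (P := P) (π := π)
  have hsnd := measurePreserving_snd_compProd h
  have hsq₁ : Integrable (fun p : S × S => g p.1 ^ 2) (π ⊗ₘ P) :=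
    hfst.integrable_comp_of_integrable hg.integrable_sq
  have hsq₂ : Integrable (fun p : S × S => g p.2 ^ 2) (π ⊗ₘ P) :=
    hsnd.integrable_comp_of_integrable hg.integrable_sq
  have hsum : Integrable (fun p : S × S => g p.1 ^ 2 + g p.2 ^ 2) (π ⊗ₘ P) := hsq₁.add hsq₂
  have hdiff : Integrable (fun p : S × S => (g p.1 - g p.2) ^ 2) (π ⊗ₘ P) :=
    ((hg.comp_measurePreserving hfst).sub (hg.comp_measurePreserving hsnd)).integrable_sq
  have hamgm : ∀ p : S × S, κ * |g p.1 ^ 2 - g p.2 ^ 2| ≤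
      (g p.1 - g p.2) ^ 2 + κ ^ 2 / 2 * (g p.1 ^ 2 + g p.2 ^ 2) := fun p => by
    rw [sq_sub_sq, abs_mul, ← sq_abs (g p.1 - g p.2)]
    nlinarith [sq_nonneg (|g p.1 - g p.2| - κ / 2 * |g p.1 + g p.2|),
      mul_nonneg (sq_nonneg (κ : ℝ)) (sq_nonneg (g p.1 - g p.2)), sq_abs (g p.1 + g p.2)]
  have hcoarea := mul_integral_le_integral_abs_sub hκ h (hgm.pow_const 2)
    (fun x => sq_nonneg (g x)) hg.integrable_sq (by simpa using hsupp)
  have hmono := integral_mono ((hsq₁.sub hsq₂).abs.const_mul (κ : ℝ))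
    (hdiff.add (hsum.const_mul ((κ : ℝ) ^ 2 / 2))) hamgm
  simp only [Pi.add_apply, Pi.sub_apply] at hmono
  rw [integral_const_mul, integral_add hdiff (hsum.const_mul _), integral_const_mul,
    integral_add hsq₁ hsq₂,
    integral_comp_of_measurePreserving hfst (g := fun x => g x ^ 2) hg.integrable_sq.1,
    integral_comp_of_measurePreserving hsnd (g := fun x => g x ^ 2) hg.integrable_sq.1] at hmono
  nlinarith [mul_le_mul_of_nonneg_left hcoarea κ.2]

theorem sq_mul_variance_le (h : P.Invariant π) {f : S → ℝ} (hfm : Measurable f)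
    (hf : MemLp f 2 π) : κ ^ 2 * Var[f; π] ≤ ∫ p, (f p.1 - f p.2) ^ 2 ∂(π ⊗ₘ P) := by
  obtain ⟨m, hgt, hlt⟩ := exists_median π hfm
  have hfst := measurePreserving_fst_compProd (P := P) (π := π)
  have hsnd := measurePreserving_snd_compProd h
  have hdiff : ∀ {g : S → ℝ}, MemLp g 2 π →
      Integrable (fun p : S × S => (g p.1 - g p.2) ^ 2) (π ⊗ₘ P) := fun hg =>
    ((hg.comp_measurePreserving hfst).sub (hg.comp_measurePreserving hsnd)).integrable_sq
  have hc : MemLp (fun x => f x - m) 2 π := hf.sub (memLp_const m)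
  have hp : MemLp (fun x => max (f x - m) 0) 2 π := hc.pos_part
  have hn : MemLp (fun x => max (-(f x - m)) 0) 2 π := hc.neg_part
  have hpos := sq_mul_integral_sq_le hκ h (g := fun x => max (f x - m) 0) (by fun_prop) hp
    (by simpa using hgt)
  have hneg := sq_mul_integral_sq_le hκ h (g := fun x => max (-(f x - m)) 0) (by fun_prop) hn
    (by simpa using hlt)
  have hsplit : ∀ p : S × S, (max (f p.1 - m) 0 - max (f p.2 - m) 0) ^ 2 +
      (max (-(f p.1 - m)) 0 - max (-(f p.2 - m)) 0) ^ 2 ≤ (f p.1 - f p.2) ^ 2 := fun p => by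
    rw [← sub_sub_sub_cancel_right (f p.1) (f p.2) m]
    exact sq_max_zero_sub_add_sq_max_neg_zero_sub_le _ _
  calc κ ^ 2 * Var[f; π] ≤ κ ^ 2 * ∫ x, (f x - m) ^ 2 ∂π := by
        rw [← variance_sub_const hf.1 m]
        gcongr
        exact variance_le_expectation_sq hc.1
    _ = κ ^ 2 * ∫ x, max (f x - m) 0 ^ 2 ∂π + κ ^ 2 * ∫ x, max (-(f x - m)) 0 ^ 2 ∂π := by
        rw [← mul_add, ← integral_add hp.integrable_sq hn.integrable_sq]
        simp only [sq_max_zero_add_sq_max_neg_zero]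
    _ ≤ ∫ p, (max (f p.1 - m) 0 - max (f p.2 - m) 0) ^ 2 ∂(π ⊗ₘ P) +
          ∫ p, (max (-(f p.1 - m)) 0 - max (-(f p.2 - m)) 0) ^ 2 ∂(π ⊗ₘ P) := add_le_add hpos hneg
    _ ≤ ∫ p, (f p.1 - f p.2) ^ 2 ∂(π ⊗ₘ P) := by
        rw [← integral_add (hdiff hp) (hdiff hn)]
        exact integral_mono ((hdiff hp).add (hdiff hn)) (hdiff hf) hsplit

end Poincare

lemma variance_indicator_one {A : Set S} (hA : MeasurableSet A) :
    Var[A.indicator 1; π] = π.real A * (1 - π.real A) := by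
  have hmem : MemLp (A.indicator (1 : S → ℝ)) 2 π :=
    (memLp_const 1).indicator hA
  have hsq : (A.indicator (1 : S → ℝ)) ^ 2 = A.indicator 1 := by
    ext x
    by_cases hx : x ∈ A <;> simp [hx]
  rw [variance_eq_sub hmem, hsq, integral_indicator_one hA]
  ring

lemma integral_sq_sub_indicator_one (h : P.IsReversible π) {A : Set S} (hA : MeasurableSet A) :
    ∫ p, (A.indicator (1 : S → ℝ) p.1 - A.indicator 1 p.2) ^ 2 ∂(π ⊗ₘ P) =
      2 * (π ⊗ₘ P).real (A ×ˢ Aᶜ) := by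
  have hsplit : ∀ p : S × S, (A.indicator (1 : S → ℝ) p.1 - A.indicator 1 p.2) ^ 2 =
      (A ×ˢ Aᶜ).indicator 1 p + (Aᶜ ×ˢ A).indicator 1 p := fun p => by
    by_cases hp₁ : p.1 ∈ A <;> by_cases hp₂ : p.2 ∈ A <;> simp [Set.indicator, hp₁, hp₂]
  have hswap : (π ⊗ₘ P).real (Aᶜ ×ˢ A) = (π ⊗ₘ P).real (A ×ˢ Aᶜ) := by
    rw [Measure.real, Measure.real, Measure.compProd_apply_prod hA.compl hA,
      Measure.compProd_apply_prod hA hA.compl, h hA.compl hA]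
  simp only [hsplit]
  rw [integral_add ((integrable_const 1).indicator (hA.prod hA.compl))
      ((integrable_const 1).indicator (hA.compl.prod hA)),
    integral_indicator_one (hA.prod hA.compl), integral_indicator_one (hA.compl.prod hA), hswap]
  ring

theorem hasSpectralGap_iff_hasPositiveConductance (h : P.IsReversible π) :
    HasSpectralGap P π ↔ HasPositiveConductance P π := by
  constructor
  · rintro ⟨c, hc, hgap⟩
    refine ⟨(c / 4).toNNReal, Real.toNNReal_pos.2 (by positivity), fun A hA hhalf => ?_⟩
    have hgapA := hgap (A.indicator 1) (measurable_one.indicator hA)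
      ((memLp_const 1).indicator hA)
    rw [variance_indicator_one hA, integral_sq_sub_indicator_one h hA] at hgapA
    have hhalf' : π.real A ≤ 1 / 2 := by
      simpa [Measure.real] using ENNReal.toReal_mono (by simp) hhalf
    have hflow : c / 4 * π.real A ≤ (π ⊗ₘ P).real (A ×ˢ Aᶜ) := by
      nlinarith [mul_nonneg hc.le (measureReal_nonneg (μ := π) (s := A))]
    rw [← Measure.compProd_apply_prod hA hA.compl, ← ofReal_measureReal, ← ofReal_measureReal,
      ← ENNReal.ofReal, ← ENNReal.ofReal_mul (by positivity)]
    exact ENNReal.ofReal_le_ofReal hflow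
  · rintro ⟨κ, hκ0, hκ⟩
    exact ⟨κ ^ 2, by positivity, fun f hfm hf => sq_mul_variance_le hκ h.invariant hfm hf⟩

theorem isVarianceBounding_iff_hasPositiveConductance (h : P.IsReversible π) :
    IsVarianceBounding P π ↔ HasPositiveConductance P π :=
  (isVarianceBounding_iff_hasSpectralGap h).trans (hasSpectralGap_iff_hasPositiveConductance h)

end Cheeger

section ProposeAcceptReject

open scoped NNReal

variable {S : Type*} [MeasurableSpace S] {μ : Measure S} [SFinite μ] {q α : S → S → ℝ}

lemma measurable_ofReal_mul (hq : Measurable (Function.uncurry q))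
    (hα : Measurable (Function.uncurry α)) :
    Measurable (Function.uncurry fun x y => ENNReal.ofReal (q x y * α x y)) :=
  (hq.mul hα).ennreal_ofReal

lemma measurable_one_sub_lintegral_accept (hq : Measurable (Function.uncurry q))
    (hα : Measurable (Function.uncurry α)) :
    Measurable fun x => 1 - ∫⁻ z, ENNReal.ofReal (q x z * α x z) ∂μ :=
  measurable_const.sub (measurable_ofReal_mul hq hα).lintegral_prod_right

lemma proposeAcceptReject_apply (hq : Measurable (Function.uncurry q))
    (hα : Measurable (Function.uncurry α)) (x : S) {B : Set S} (hB : MeasurableSet B) :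
    proposeAcceptReject μ q α x B = ∫⁻ y in B, ENNReal.ofReal (q x y * α x y) ∂μ +
      B.indicator (fun x => 1 - ∫⁻ z, ENNReal.ofReal (q x z * α x z) ∂μ) x := by
  classical
  have hreject : Measurable (Function.uncurry fun (x : S) (_ : S) =>
      1 - ∫⁻ z, ENNReal.ofReal (q x z * α x z) ∂μ) :=
    (measurable_one_sub_lintegral_accept hq hα).comp measurable_fst
  rw [proposeAcceptReject, add_apply, Measure.add_apply,
    Kernel.withDensity_apply' _ (measurable_ofReal_mul hq hα),
    Kernel.withDensity_apply' _ hreject, Kernel.const_apply, Kernel.id_apply,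
    setLIntegral_dirac' measurable_const hB]
  rfl

lemma proposeAcceptReject_apply_of_notMem (hq : Measurable (Function.uncurry q))
    (hα : Measurable (Function.uncurry α)) {x : S} {B : Set S} (hB : MeasurableSet B)
    (hx : x ∉ B) :
    proposeAcceptReject μ q α x B = ∫⁻ y in B, ENNReal.ofReal (q x y * α x y) ∂μ := by
  rw [proposeAcceptReject_apply hq hα x hB, Set.indicator_of_notMem hx, add_zero]

lemma isMarkovKernel_proposeAcceptReject (hq : IsProposalDensity μ q)
    (hα : Measurable (Function.uncurry α)) (hα1 : ∀ x y, α x y ≤ 1) :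
    IsMarkovKernel (proposeAcceptReject μ q α) := by
  refine ⟨fun x => ⟨?_⟩⟩
  have hle : ∫⁻ z, ENNReal.ofReal (q x z * α x z) ∂μ ≤ 1 :=
    calc ∫⁻ z, ENNReal.ofReal (q x z * α x z) ∂μ ≤ ∫⁻ z, ENNReal.ofReal (q x z) ∂μ :=
          lintegral_mono fun z => ENNReal.ofReal_le_ofReal
            (mul_le_of_le_one_right (hq.nonneg x z) (hα1 x z))
      _ = 1 := hq.lintegral_eq_one x
  rw [proposeAcceptReject_apply hq.measurable hα x MeasurableSet.univ, setLIntegral_univ,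
    Set.indicator_univ, add_tsub_cancel_of_le hle]

lemma setLIntegral_proposeAcceptReject {p : S → ℝ} (hp : Measurable p) (hp0 : ∀ x, 0 ≤ p x)
    (hq : Measurable (Function.uncurry q)) (hα : Measurable (Function.uncurry α))
    {A B : Set S} (hA : MeasurableSet A) (hB : MeasurableSet B) :
    ∫⁻ x in A, proposeAcceptReject μ q α x B ∂(μ.withDensity fun x => ENNReal.ofReal (p x)) =
      ∫⁻ x in A, ∫⁻ y in B, ENNReal.ofReal (p x * (q x y * α x y)) ∂μ ∂μ +
        ∫⁻ x in A ∩ B, ENNReal.ofReal (p x) *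
          (1 - ∫⁻ z, ENNReal.ofReal (q x z * α x z) ∂μ) ∂μ := by
  have hreject : Measurable fun x => ENNReal.ofReal (p x) *
      (1 - ∫⁻ z, ENNReal.ofReal (q x z * α x z) ∂μ) :=
    hp.ennreal_ofReal.mul (measurable_one_sub_lintegral_accept hq hα)
  rw [setLIntegral_withDensity_eq_setLIntegral_mul _ hp.ennreal_ofReal
      (Kernel.measurable_coe _ hB) hA, Set.inter_comm, ← Measure.restrict_restrict hB,
    ← lintegral_indicator hB, ← lintegral_add_right _ (hreject.indicator hB)]
  refine lintegral_congr fun x => ?_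
  have hqα : Measurable fun y => ENNReal.ofReal (q x y * α x y) :=
    (measurable_ofReal_mul hq hα).comp measurable_prodMk_left
  rw [Pi.mul_apply, proposeAcceptReject_apply hq hα x hB, mul_add, ← lintegral_const_mul _ hqα,
    Set.indicator_mul_right]
  simp only [ENNReal.ofReal_mul (hp0 x)]

lemma isReversible_proposeAcceptReject {p : S → ℝ} (hp : Measurable p) (hp0 : ∀ x, 0 ≤ p x)
    (hq : Measurable (Function.uncurry q)) (hα : Measurable (Function.uncurry α))
    (hbalance : ∀ x y, p x * (q x y * α x y) = p y * (q y x * α y x)) :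
    (proposeAcceptReject μ q α).IsReversible (μ.withDensity fun x => ENNReal.ofReal (p x)) := by
  intro A B hA hB
  have hflow : Measurable fun z : S × S => ENNReal.ofReal (p z.1 * (q z.1 z.2 * α z.1 z.2)) :=
    ((hp.comp measurable_fst).mul (hq.mul hα)).ennreal_ofReal
  rw [setLIntegral_proposeAcceptReject hp hp0 hq hα hA hB,
    setLIntegral_proposeAcceptReject hp hp0 hq hα hB hA, Set.inter_comm A B,
    lintegral_lintegral_swap hflow.aemeasurable]
  simp_rw [hbalance]

lemma mul_proposeAcceptReject_le {α' : S → S → ℝ} (hq : IsProposalDensity μ q)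
    (hα : Measurable (Function.uncurry α)) (hα' : Measurable (Function.uncurry α'))
    (hα1 : ∀ x y, α x y ≤ 1) (c : ℝ≥0) {x : S} {B : Set S} (hB : MeasurableSet B) (hx : x ∉ B) :
    c * proposeAcceptReject μ q α x B ≤ proposeAcceptReject μ q α' x B +
      c * ∫⁻ y in {y | α' x y < c * α x y}, ENNReal.ofReal (q x y) ∂μ := by
  have hqα : Measurable fun y => ENNReal.ofReal (q x y * α x y) :=
    (measurable_ofReal_mul hq.measurable hα).comp measurable_prodMk_left
  have hqα' : Measurable fun y => ENNReal.ofReal (q x y * α' x y) :=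
    (measurable_ofReal_mul hq.measurable hα').comp measurable_prodMk_left
  have hqx : Measurable fun y => ENNReal.ofReal (q x y) :=
    (hq.measurable.comp measurable_prodMk_left).ennreal_ofReal
  have hbad : MeasurableSet {y | α' x y < c * α x y} :=
    measurableSet_lt (hα'.comp measurable_prodMk_left)
      ((hα.comp measurable_prodMk_left).const_mul _)
  have hpoint : ∀ y, c * ENNReal.ofReal (q x y * α x y) ≤ ENNReal.ofReal (q x y * α' x y) +
      {y | α' x y < c * α x y}.indicator (fun y => c * ENNReal.ofReal (q x y)) y := by
    intro y
    by_cases hy : α' x y < c * α x y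
    · rw [Set.indicator_of_mem (s := {y | α' x y < c * α x y}) hy]
      refine le_add_left (mul_le_mul_right (ENNReal.ofReal_le_ofReal ?_) _)
      exact mul_le_of_le_one_right (hq.nonneg x y) (hα1 x y)
    · refine le_add_right ?_
      rw [← ENNReal.ofReal_coe_nnreal, ← ENNReal.ofReal_mul c.coe_nonneg, mul_left_comm]
      exact ENNReal.ofReal_le_ofReal (mul_le_mul_of_nonneg_left (not_lt.1 hy) (hq.nonneg x y))
  rw [proposeAcceptReject_apply_of_notMem hq.measurable hα hB hx,
    proposeAcceptReject_apply_of_notMem hq.measurable hα' hB hx, ← lintegral_const_mul _ hqα,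
    ← lintegral_const_mul _ hqx, ← lintegral_indicator hbad]
  calc ∫⁻ y in B, c * ENNReal.ofReal (q x y * α x y) ∂μ
      ≤ ∫⁻ y in B, ENNReal.ofReal (q x y * α' x y) ∂μ +
          ∫⁻ y in B, {y | α' x y < c * α x y}.indicator
            (fun y => c * ENNReal.ofReal (q x y)) y ∂μ :=
        (lintegral_mono hpoint).trans_eq (lintegral_add_left hqα' _)
    _ ≤ _ := add_le_add le_rfl (setLIntegral_le_lintegral _ _)

theorem hasPositiveConductance_of_accept_le {α' : S → S → ℝ} {ν : Measure S} [IsFiniteMeasure ν]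
    (hq : IsProposalDensity μ q) (hα : Measurable (Function.uncurry α))
    (hα' : Measurable (Function.uncurry α')) (hα1 : ∀ x y, α x y ≤ 1)
    (hcomp : ∀ ε : ℝ≥0, 0 < ε → ∃ c : ℝ≥0, 0 < c ∧ ∀ᵐ x ∂ν,
      ∫⁻ y in {y | α' x y < c * α x y}, ENNReal.ofReal (q x y) ∂μ ≤ ε)
    (h : HasPositiveConductance (proposeAcceptReject μ q α) ν) :
    HasPositiveConductance (proposeAcceptReject μ q α') ν := by
  obtain ⟨κ, hκ0, hκ⟩ := h
  obtain ⟨c, hc0, hc⟩ := hcomp (κ / 2) (by positivity)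
  refine ⟨c * (κ / 2), by positivity, fun A hA hhalf => ?_⟩
  set flow := ∫⁻ x in A, proposeAcceptReject μ q α x Aᶜ ∂ν
  set flow' := ∫⁻ x in A, proposeAcceptReject μ q α' x Aᶜ ∂ν
  have hflow : c * flow ≤ flow' + (c * (κ / 2) : ℝ≥0) * ν A := by
    rw [← lintegral_const_mul _ (Kernel.measurable_coe _ hA.compl), ← setLIntegral_const,
      ← lintegral_add_right _ measurable_const]
    refine lintegral_mono_ae ((ae_restrict_iff' hA).2 (hc.mono fun x hx hxA => ?_))
    grw [mul_proposeAcceptReject_le hq hα hα' hα1 c hA.compl (Set.notMem_compl_iff.2 hxA), hx,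
      ENNReal.coe_mul]
  have hconductance : (c * (κ / 2) : ℝ≥0) * ν A + (c * (κ / 2) : ℝ≥0) * ν A ≤ c * flow := by
    rw [← add_mul, ← ENNReal.coe_add, ← mul_add, add_halves, ENNReal.coe_mul, mul_assoc]
    gcongr
    exact hκ A hA hhalf
  exact ENNReal.le_of_add_le_add_right (ENNReal.mul_ne_top ENNReal.coe_ne_top (measure_ne_top ν A))
    (hconductance.trans hflow)

end ProposeAcceptReject

section Acceptance

variable {S : Type*} {π π' : S → ℝ} {q : S → S → ℝ} {x y : S}

lemma acceptMH_le_one (x y : S) : acceptMH π q x y ≤ 1 := min_le_left _ _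

lemma ratioMH_nonneg (hπ : ∀ x, 0 < π x) (hq : ∀ x y, 0 ≤ q x y) (x y : S) :
    0 ≤ ratioMH π q x y :=
  div_nonneg (mul_nonneg (hπ y).le (hq y x)) (mul_nonneg (hπ x).le (hq x y))

lemma ratioDA₂_pos (hπ : ∀ x, 0 < π x) (hπ' : ∀ x, 0 < π' x) (x y : S) :
    0 < ratioDA₂ π π' x y :=
  div_pos (div_pos (hπ y) (hπ' y)) (div_pos (hπ x) (hπ' x))

lemma acceptDA_le_one (hπ : ∀ x, 0 < π x) (hπ' : ∀ x, 0 < π' x) (x y : S) :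
    acceptDA π π' q x y ≤ 1 :=
  mul_le_one₀ (min_le_left _ _) (le_min zero_le_one (ratioDA₂_pos hπ hπ' x y).le)
    (min_le_left _ _)

lemma acceptDA_nonneg (hπ : ∀ x, 0 < π x) (hπ' : ∀ x, 0 < π' x) (hq : ∀ x y, 0 ≤ q x y)
    (x y : S) : 0 ≤ acceptDA π π' q x y :=
  mul_nonneg (le_min zero_le_one (ratioMH_nonneg hπ' hq x y))
    (le_min zero_le_one (ratioDA₂_pos hπ hπ' x y).le)

lemma mul_min_one_div {a b : ℝ} (ha : 0 ≤ a) (hb : 0 ≤ b) : a * min 1 (b / a) = min a b := by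
  rcases ha.eq_or_lt with rfl | ha
  · simp [hb]
  · rw [mul_min_of_nonneg _ _ ha.le, mul_one, mul_div_cancel₀ _ ha.ne']

lemma acceptMH_detailed_balance (hπ : ∀ x, 0 < π x) (hq : ∀ x y, 0 ≤ q x y) (x y : S) :
    π x * (q x y * acceptMH π q x y) = π y * (q y x * acceptMH π q y x) := by
  rw [← mul_assoc, ← mul_assoc, acceptMH, acceptMH, ratioMH, ratioMH,
    mul_min_one_div (mul_nonneg (hπ x).le (hq x y)) (mul_nonneg (hπ y).le (hq y x)),
    mul_min_one_div (mul_nonneg (hπ y).le (hq y x)) (mul_nonneg (hπ x).le (hq x y)), min_comm]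

lemma acceptDA_detailed_balance (hπ : ∀ x, 0 < π x) (hπ' : ∀ x, 0 < π' x)
    (hq : ∀ x y, 0 ≤ q x y) (x y : S) :
    π x * (q x y * acceptDA π π' q x y) = π y * (q y x * acceptDA π π' q y x) := by
  have hfactor : ∀ x y, π x * (q x y * acceptDA π π' q x y) =
      π' x * (q x y * acceptMH π' q x y) * (π x / π' x * min 1 (ratioDA₂ π π' x y)) := by
    intro x y
    have := (hπ' x).ne'
    rw [acceptDA, acceptMH]
    field_simp
  have hpos : ∀ x, 0 ≤ π x / π' x := fun x => (div_pos (hπ x) (hπ' x)).le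
  rw [hfactor, hfactor, acceptMH_detailed_balance hπ' hq, ratioDA₂, ratioDA₂,
    mul_min_one_div (hpos x) (hpos y), mul_min_one_div (hpos y) (hpos x), min_comm (π x / π' x)]

lemma ratioMH_eq_mul_ratioDA₂ (hπ : ∀ x, 0 < π x) (hπ' : ∀ x, 0 < π' x) (x y : S) :
    ratioMH π q x y = ratioMH π' q x y * ratioDA₂ π π' x y := by
  have hx := (hπ x).ne'
  have hx' := (hπ' x).ne'
  have hy' := (hπ' y).ne'
  rw [ratioMH, ratioMH, ratioDA₂]
  field_simp

lemma acceptMH_eq_zero (h : q x y = 0 ∨ q y x = 0) : acceptMH π q x y = 0 := by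
  rcases h with h | h <;> simp [acceptMH, ratioMH, h]

lemma min_one_eq_exp_min_zero_log {r : ℝ} (hr : 0 < r) :
    min 1 r = Real.exp (min 0 (Real.log r)) := by
  rw [Real.exp_monotone.map_min, Real.exp_zero, Real.exp_log hr]

lemma exp_neg_mul_acceptMH_le_acceptDA (hπ : ∀ x, 0 < π x) (hπ' : ∀ x, 0 < π' x)
    (hq : ∀ x y, 0 ≤ q x y) {C : ℝ}
    (hC : 0 < q x y → 0 < q y x →
      min 0 (Real.log (ratioMH π' q x y) + Real.log (ratioDA₂ π π' x y)) - C ≤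
        min 0 (Real.log (ratioMH π' q x y)) + min 0 (Real.log (ratioDA₂ π π' x y))) :
    Real.exp (-C) * acceptMH π q x y ≤ acceptDA π π' q x y := by
  by_cases hzero : q x y = 0 ∨ q y x = 0
  · rw [acceptMH_eq_zero hzero, mul_zero]
    exact acceptDA_nonneg hπ hπ' hq x y
  obtain ⟨hxy, hyx⟩ := not_or.1 hzero
  replace hxy := (hq x y).lt_of_ne' hxy
  replace hyx := (hq y x).lt_of_ne' hyx
  have hr₁ : 0 < ratioMH π' q x y := div_pos (mul_pos (hπ' y) hyx) (mul_pos (hπ' x) hxy)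
  have hr₂ := ratioDA₂_pos hπ hπ' x y
  rw [acceptMH, acceptDA, ratioMH_eq_mul_ratioDA₂ hπ hπ',
    min_one_eq_exp_min_zero_log (mul_pos hr₁ hr₂), min_one_eq_exp_min_zero_log hr₁,
    min_one_eq_exp_min_zero_log hr₂, Real.log_mul hr₁.ne' hr₂.ne', ← Real.exp_add,
    ← Real.exp_add, Real.exp_le_exp]
  linarith [hC hxy hyx]

lemma min_zero_add_le_of_sign_mul_sign_nonneg {a b : ℝ} (h : 0 ≤ Real.sign a * Real.sign b) :
    min 0 (a + b) ≤ min 0 a + min 0 b := by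
  rcases lt_trichotomy a 0 with ha | rfl | ha
  · rcases le_or_gt b 0 with hb | hb
    · rw [min_eq_right ha.le, min_eq_right hb]
      exact min_le_right _ _
    · norm_num [Real.sign_of_neg ha, Real.sign_of_pos hb] at h
  · simp
  · rcases lt_or_ge b 0 with hb | hb
    · norm_num [Real.sign_of_pos ha, Real.sign_of_neg hb] at h
    · rw [min_eq_left ha.le, min_eq_left hb, add_zero]
      exact min_le_left _ _

lemma min_zero_add_sub_abs_le (a b : ℝ) : min 0 (a + b) - |b| ≤ min 0 a + min 0 b := by
  grind

lemma min_zero_add_add_sub_abs_le {s t : ℝ} (Δ : ℝ) (hpos : 0 ≤ s → 0 ≤ t)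
    (hneg : s ≤ 0 → t ≤ 0) : min 0 (s + Δ + t) - |Δ| ≤ min 0 (s + Δ) + min 0 t := by
  grind

lemma acceptMH_le_acceptDA_of_mem_noProblemSet (hπ : ∀ x, 0 < π x) (hπ' : ∀ x, 0 < π' x)
    (hq : ∀ x y, 0 ≤ q x y) (hy : y ∈ noProblemSet π π' q x) :
    acceptMH π q x y ≤ acceptDA π π' q x y := by
  have hbound := exp_neg_mul_acceptMH_le_acceptDA (C := 0) hπ hπ' hq fun _ _ =>
    (sub_zero _).trans_le (min_zero_add_le_of_sign_mul_sign_nonneg hy)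
  rwa [neg_zero, Real.exp_zero, one_mul] at hbound

lemma exp_neg_abs_log_ratioDA₂_mul_acceptMH_le_acceptDA (hπ : ∀ x, 0 < π x)
    (hπ' : ∀ x, 0 < π' x) (hq : ∀ x y, 0 ≤ q x y) (x y : S) :
    Real.exp (-|Real.log (ratioDA₂ π π' x y)|) * acceptMH π q x y ≤ acceptDA π π' q x y :=
  exp_neg_mul_acceptMH_le_acceptDA hπ hπ' hq fun _ _ => min_zero_add_sub_abs_le _ _

lemma log_ratioDA₂ (hπ : ∀ x, 0 < π x) (hπ' : ∀ x, 0 < π' x) (x y : S) :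
    Real.log (ratioDA₂ π π' x y) = Real.log (π y / π' y) - Real.log (π x / π' x) :=
  Real.log_div (div_pos (hπ y) (hπ' y)).ne' (div_pos (hπ x) (hπ' x)).ne'

lemma log_ratioMH (hπ : ∀ x, 0 < π x) (hxy : 0 < q x y) (hyx : 0 < q y x) :
    Real.log (ratioMH π q x y) = Real.log (π y) - Real.log (π x) + logProposalRatio q x y := by
  rw [ratioMH, logProposalRatio, Real.log_div (mul_pos (hπ y) hyx).ne' (mul_pos (hπ x) hxy).ne',
    Real.log_mul (hπ y).ne' hyx.ne', Real.log_mul (hπ x).ne' hxy.ne']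
  ring

lemma log_div_le_log_div_of_div_le_div {a b a' b' : ℝ} (ha : 0 < a) (ha' : 0 < a')
    (hb : 0 < b) (hb' : 0 < b') (h : a' / a ≤ b' / b) : Real.log (b / b') ≤ Real.log (a / a') := by
  refine Real.log_le_log (div_pos hb hb') ?_
  rw [← inv_div b' b, ← inv_div a' a]
  exact inv_anti₀ (div_pos ha' ha) h

/-- When the change of `log π'` and `log r₂` agree in sign, `log r₁` and `log r₂` can only disagree
in sign through `Δ`. -/
lemma exp_neg_abs_logProposalRatio_mul_acceptMH_le_acceptDA (hπ : ∀ x, 0 < π x)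
    (hπ' : ∀ x, 0 < π' x) (hq : ∀ x y, 0 ≤ q x y)
    (hxy : π' x ≤ π' y → π' y / π y ≤ π' x / π x)
    (hyx : π' y ≤ π' x → π' x / π x ≤ π' y / π y) :
    Real.exp (-|logProposalRatio q x y|) * acceptMH π q x y ≤ acceptDA π π' q x y := by
  refine exp_neg_mul_acceptMH_le_acceptDA hπ hπ' hq fun hqxy hqyx => ?_
  rw [log_ratioMH hπ' hqxy hqyx, log_ratioDA₂ hπ hπ']
  refine min_zero_add_add_sub_abs_le _ (fun h => ?_) fun h => ?_
  · exact sub_nonneg.2 (log_div_le_log_div_of_div_le_div (hπ y) (hπ' y) (hπ x) (hπ' x)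
      (hxy ((Real.log_le_log_iff (hπ' x) (hπ' y)).1 (sub_nonneg.1 h))))
  · exact sub_nonpos.2 (log_div_le_log_div_of_div_le_div (hπ x) (hπ' x) (hπ y) (hπ' y)
      (hyx ((Real.log_le_log_iff (hπ' y) (hπ' x)).1 (sub_nonpos.1 h))))

end Acceptance

section Measurability

variable {S : Type*} [MeasurableSpace S] {π π' : S → ℝ} {q : S → S → ℝ}

lemma measurable_acceptMH (hπ : Measurable π) (hq : Measurable (Function.uncurry q)) :
    Measurable (Function.uncurry (acceptMH π q)) :=
  measurable_const.min (((hπ.comp measurable_snd).mul (hq.comp measurable_swap)).div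
    ((hπ.comp measurable_fst).mul hq))

lemma measurable_acceptDA (hπ : Measurable π) (hπ' : Measurable π')
    (hq : Measurable (Function.uncurry q)) : Measurable (Function.uncurry (acceptDA π π' q)) :=
  (measurable_acceptMH hπ' hq).mul (measurable_const.min
    (((hπ.div hπ').comp measurable_snd).div ((hπ.div hπ').comp measurable_fst)))

end Measurability

section HeavyTails

open scoped NNReal

variable {S E : Type*} [AddGroup E] {N : AddGroupSeminorm E} {v : S → E} {π π' : S → ℝ}
  {q : S → S → ℝ}

lemma exp_neg_mul_acceptMH_le_acceptDA_of_heavyTails (hπ : ∀ x, 0 < π x) (hπ' : ∀ x, 0 < π' x)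
    (hq : ∀ x y, 0 ≤ q x y) {r ρ L C : ℝ}
    (hheavy : ∀ x y, r < N (v x) → r < N (v y) → π' x ≤ π' y → π' y / π y ≤ π' x / π x)
    (hL : ∀ x, N (v x) ≤ r + ρ → |Real.log (π x / π' x)| ≤ L) (hC : 2 * L ≤ C) {x y : S}
    (hΔ : |logProposalRatio q x y| ≤ C) (hyx : N (v y - v x) < ρ) :
    Real.exp (-C) * acceptMH π q x y ≤ acceptDA π π' q x y := by
  have hMH : 0 ≤ acceptMH π q x y := le_min zero_le_one (ratioMH_nonneg hπ hq x y)
  by_cases hfar : r < N (v x) ∧ r < N (v y)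
  · grw [← hΔ]
    exact exp_neg_abs_logProposalRatio_mul_acceptMH_le_acceptDA hπ hπ' hq
      (hheavy x y hfar.1 hfar.2) (hheavy y x hfar.2 hfar.1)
  · have hdist : |N (v y) - N (v x)| < ρ := (abs_sub_map_le_sub N _ _).trans_lt hyx
    have hnear : N (v x) ≤ r + ρ ∧ N (v y) ≤ r + ρ := by grind
    have hr₂ : |Real.log (ratioDA₂ π π' x y)| ≤ C := by
      rw [log_ratioDA₂ hπ hπ']
      linarith [abs_sub (Real.log (π y / π' y)) (Real.log (π x / π' x)), hL x hnear.1,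
        hL y hnear.2]
    grw [← hr₂]
    exact exp_neg_abs_log_ratioDA₂_mul_acceptMH_le_acceptDA hπ hπ' hq x y

variable [MeasurableSpace S] {μ : Measure S}

lemma exists_lintegral_acceptDA_lt_le {ν : Measure S} (hπ : ∀ x, 0 < π x) (hπ' : ∀ x, 0 < π' x)
    (hq : ∀ x y, 0 ≤ q x y)
    (hlog : ∀ R, ∃ L, ∀ x, N (v x) ≤ R → |Real.log (π x / π' x)| ≤ L)
    (hlocal : ∀ ε : ℝ, 0 < ε → ∃ ρ : ℝ, ∀ x,
      ∫⁻ y in {y | N (v y - v x) < ρ}ᶜ, ENNReal.ofReal (q x y) ∂μ < ENNReal.ofReal ε)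
    (hheavy : ∃ r, ∀ x y, r < N (v x) → r < N (v y) → π' x ≤ π' y → π' y / π y ≤ π' x / π x)
    (hΔ : ∀ ε : ℝ, 0 < ε → ∃ (D : S → Set S) (h : ℝ → ℝ), (∀ R, BddAbove (h '' Set.Icc 0 R)) ∧
      ∀ᵐ x ∂ν, ∫⁻ y in (D x)ᶜ, ENNReal.ofReal (q x y) ∂μ ≤ ENNReal.ofReal ε ∧
        {y | y ∈ D x ∧ h (N (v y - v x)) < |logProposalRatio q x y|} ⊆ noProblemSet π π' q x)
    {ε : ℝ≥0} (hε : 0 < ε) :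
    ∃ c : ℝ≥0, 0 < c ∧ ∀ᵐ x ∂ν, ∫⁻ y in {y | acceptDA π π' q x y < c * acceptMH π q x y},
      ENNReal.ofReal (q x y) ∂μ ≤ ε := by
  obtain ⟨ρ, hρ⟩ := hlocal (ε / 2) (by positivity)
  obtain ⟨D, h, hbdd, hD⟩ := hΔ (ε / 2) (by positivity)
  obtain ⟨r, hr⟩ := hheavy
  obtain ⟨L, hL⟩ := hlog (r + ρ)
  obtain ⟨H, hH⟩ := hbdd ρ
  set C := max 0 (max H (2 * L))
  refine ⟨(Real.exp (-C)).toNNReal, Real.toNNReal_pos.2 (Real.exp_pos _), ?_⟩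
  rw [Real.coe_toNNReal _ (Real.exp_pos _).le]
  filter_upwards [hD] with x ⟨hDx, hsub⟩
  have hbad : {y | acceptDA π π' q x y < Real.exp (-C) * acceptMH π q x y} ⊆
      (D x)ᶜ ∪ {y | N (v y - v x) < ρ}ᶜ := by
    refine fun y => not_imp_not.1 fun hgood => ?_
    simp only [Set.mem_union, Set.mem_compl_iff, Set.mem_ofPred_eq, not_or, not_not] at hgood
    obtain ⟨hyD, hyρ⟩ := hgood
    have hhC : h (N (v y - v x)) ≤ C :=
      (hH ⟨_, ⟨apply_nonneg N _, hyρ.le⟩, rfl⟩).trans ((le_max_left _ _).trans (le_max_right _ _))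
    rw [Set.mem_ofPred_eq, not_lt]
    rcases le_or_gt |logProposalRatio q x y| C with hΔy | hΔy
    · exact exp_neg_mul_acceptMH_le_acceptDA_of_heavyTails hπ hπ' hq hr hL
        ((le_max_right _ _).trans (le_max_right _ _)) hΔy hyρ
    · calc Real.exp (-C) * acceptMH π q x y ≤ acceptMH π q x y :=
            mul_le_of_le_one_left (le_min zero_le_one (ratioMH_nonneg hπ hq x y))
              (Real.exp_le_one_iff.2 (neg_nonpos.2 (le_max_left _ _)))
        _ ≤ acceptDA π π' q x y := acceptMH_le_acceptDA_of_mem_noProblemSet hπ hπ' hq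
            (hsub ⟨hyD, hhC.trans_lt hΔy⟩)
  calc _ ≤ ∫⁻ y in (D x)ᶜ, ENNReal.ofReal (q x y) ∂μ +
          ∫⁻ y in {y | N (v y - v x) < ρ}ᶜ, ENNReal.ofReal (q x y) ∂μ :=
        (lintegral_mono_set hbad).trans (lintegral_union_le _ _ _)
    _ ≤ ENNReal.ofReal (ε / 2) + ENNReal.ofReal (ε / 2) := add_le_add hDx (hρ x).le
    _ = ε := by
      rw [← ENNReal.ofReal_add (by positivity) (by positivity), add_halves,
        ENNReal.ofReal_coe_nnreal]

theorem theorem3_general [SFinite μ] (hπm : Measurable π) (hπ'm : Measurable π')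
    (hπ : ∀ x, 0 < π x) (hπ' : ∀ x, 0 < π' x) (hπ_one : ∫⁻ x, ENNReal.ofReal (π x) ∂μ = 1)
    (hlog : ∀ R, ∃ L, ∀ x, N (v x) ≤ R → |Real.log (π x / π' x)| ≤ L)
    (hq : IsProposalDensity μ q)
    (hlocal : ∀ ε : ℝ, 0 < ε → ∃ ρ : ℝ, ∀ x,
      ∫⁻ y in {y | N (v y - v x) < ρ}ᶜ, ENNReal.ofReal (q x y) ∂μ < ENNReal.ofReal ε)
    (hheavy : ∃ r, ∀ x y, r < N (v x) → r < N (v y) → π' x ≤ π' y → π' y / π y ≤ π' x / π x)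
    (hΔ : ∀ ε : ℝ, 0 < ε → ∃ (D : S → Set S) (h : ℝ → ℝ), (∀ R, BddAbove (h '' Set.Icc 0 R)) ∧
      ∀ᵐ x ∂(μ.withDensity fun x => ENNReal.ofReal (π x)),
        ∫⁻ y in (D x)ᶜ, ENNReal.ofReal (q x y) ∂μ ≤ ENNReal.ofReal ε ∧
        {y | y ∈ D x ∧ h (N (v y - v x)) < |logProposalRatio q x y|} ⊆ noProblemSet π π' q x)
    (hMH : IsVarianceBounding (proposeAcceptReject μ q (acceptMH π q))
      (μ.withDensity fun x => ENNReal.ofReal (π x))) :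
    IsVarianceBounding (proposeAcceptReject μ q (acceptDA π π' q))
      (μ.withDensity fun x => ENNReal.ofReal (π x)) := by
  have hMHm := measurable_acceptMH hπm hq.measurable
  have hDAm := measurable_acceptDA hπm hπ'm hq.measurable
  have hprob : IsProbabilityMeasure (μ.withDensity fun x => ENNReal.ofReal (π x)) :=
    ⟨by rw [withDensity_apply _ MeasurableSet.univ, setLIntegral_univ, hπ_one]⟩
  have hmarkovMH := isMarkovKernel_proposeAcceptReject hq hMHm acceptMH_le_one
  have hmarkovDA := isMarkovKernel_proposeAcceptReject hq hDAm (acceptDA_le_one hπ hπ')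
  have hrevMH := isReversible_proposeAcceptReject (μ := μ) hπm (fun x => (hπ x).le)
    hq.measurable hMHm (acceptMH_detailed_balance hπ hq.nonneg)
  have hrevDA := isReversible_proposeAcceptReject (μ := μ) hπm (fun x => (hπ x).le)
    hq.measurable hDAm (acceptDA_detailed_balance hπ hπ' hq.nonneg)
  rw [isVarianceBounding_iff_hasPositiveConductance hrevDA]
  exact hasPositiveConductance_of_accept_le hq hMHm hDAm acceptMH_le_one
    (fun ε => exists_lintegral_acceptDA_lt_le hπ hπ' hq.nonneg hlog hlocal hheavy hΔ)
    ((isVarianceBounding_iff_hasPositiveConductance hrevMH).1 hMH)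

end HeavyTails

section FiniteDimensional

variable {E : Type*} [NormedAddCommGroup E] [NormedSpace ℝ E] [FiniteDimensional ℝ E]
  {N : Seminorm ℝ E}

lemma continuous_seminorm (N : Seminorm ℝ E) : Continuous N :=
  continuousOn_univ.1 (N.convexOn.continuousOn isOpen_univ)

lemma exists_pos_mul_norm_le_seminorm (hN : ∀ x, N x = 0 → x = 0) :
    ∃ a > 0, ∀ x, a * ‖x‖ ≤ N x := by
  obtain ⟨a, ha0, ha⟩ := (isCompact_sphere (0 : E) 1).exists_forall_le'
    (continuous_seminorm N).continuousOn (a := 0) fun x hx =>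
      (apply_nonneg N x).lt_of_ne' fun h => by simp [hN x h] at hx
  refine ⟨a, ha0, fun x => ?_⟩
  rcases eq_or_ne x 0 with rfl | hx
  · simp
  · have hpos := norm_pos_iff.2 hx
    have hunit := ha (‖x‖⁻¹ • x) (by simp [norm_smul, hpos.ne'])
    rwa [map_smul_eq_mul, norm_inv, norm_norm, inv_mul_eq_div, le_div_iff₀ hpos] at hunit

lemma isCompact_setOf_seminorm_le (hN : ∀ x, N x = 0 → x = 0) (R : ℝ) :
    IsCompact {x | N x ≤ R} := by
  obtain ⟨a, ha0, ha⟩ := exists_pos_mul_norm_le_seminorm hN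
  refine Metric.isCompact_of_isClosed_isBounded
    (isClosed_le (continuous_seminorm N) continuous_const)
    (Metric.isBounded_closedBall (x := (0 : E)) (r := R / a) |>.subset fun x hx => ?_)
  rw [mem_closedBall_zero_iff, le_div_iff₀' ha0]
  exact (ha x).trans hx

lemma exists_abs_le_of_continuousOn_closure (hN : ∀ x, N x = 0 → x = 0) {X : Set E} {f : E → ℝ}
    (hf : ContinuousOn f (closure X)) (R : ℝ) : ∃ L, ∀ x ∈ X, N x ≤ R → |f x| ≤ L := by
  obtain ⟨L, hL⟩ := ((isCompact_setOf_seminorm_le hN R).inter_left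
    isClosed_closure).exists_bound_of_continuousOn (hf.mono Set.inter_subset_left)
  exact ⟨L, fun x hx hxR => hL x ⟨subset_closure hx, hxR⟩⟩

end FiniteDimensional

lemma measurable_comp_val {d : ℕ} {X : Set (EuclideanSpace ℝ (Fin d))}
    {f : EuclideanSpace ℝ (Fin d) → ℝ} (hf : ContinuousOn f (closure X)) :
    Measurable fun x : StateSpace X => f x.val := by
  classical
  have hpiecewise : Measurable ((closure X).piecewise f 0) :=
    hf.measurable_piecewise continuousOn_const isClosed_closure.measurableSet
  have hcomp : (fun x : StateSpace X => f x.val) = fun x => (closure X).piecewise f 0 x.val :=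
    funext fun x => (Set.piecewise_eq_of_mem _ _ _ (subset_closure x.2)).symm
  rw [hcomp]
  exact fun s hs => ⟨_, (hpiecewise hs).nullMeasurableSet, rfl⟩

theorem theorem3 {d : ℕ} (X : Set (EuclideanSpace ℝ (Fin d)))
    (hX : NullMeasurableSet X volume)
    -- the norm on `ℝᵈ`
    (N : Seminorm ℝ (EuclideanSpace ℝ (Fin d))) (hN : ∀ x, N x = 0 → x = 0)
    -- the target density and the surrogate, continuous and positive
    (π π' : EuclideanSpace ℝ (Fin d) → ℝ)
    (hπ_cont : ContinuousOn π (closure X)) (hπ_pos : ∀ x ∈ closure X, 0 < π x)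
    (hπ'_cont : ContinuousOn π' (closure X)) (hπ'_pos : ∀ x ∈ closure X, 0 < π' x)
    (hπ_one : ∫⁻ x : StateSpace X, ENNReal.ofReal (π x.val) ∂(StateSpace.lebesgue X) = 1)
    -- the proposal
    (q : StateSpace X → StateSpace X → ℝ)
    (hq : IsProposalDensity (StateSpace.lebesgue X) q)
    (hlocal : IsLocalProposal N q)
    (hheavy : HasHeavyTails N (fun x : StateSpace X => π' x.val)
      (fun x : StateSpace X => π x.val))
    -- the control on `Δ(x, y; q)` outside the "no problem" set
    (hΔ : ∀ ε : ℝ, 0 < ε → ∃ (D : StateSpace X → Set (StateSpace X)) (h : ℝ → ℝ),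
      (∀ r, 0 ≤ r → 0 ≤ h r) ∧ (∀ R, BddAbove (h '' Set.Icc 0 R)) ∧
      ∀ᵐ x ∂(target (fun x : StateSpace X => π x.val)),
        MeasurableSet (D x) ∧
        ∫⁻ y in (D x)ᶜ, ENNReal.ofReal (q x y) ∂(StateSpace.lebesgue X) ≤ ENNReal.ofReal ε ∧
        {y | y ∈ D x ∧ h (N (y.val - x.val)) < |logProposalRatio q x y|} ⊆
          noProblemSet (fun x : StateSpace X => π x.val) (fun x : StateSpace X => π' x.val) q x)
    (hMH : IsVarianceBounding (kernelMH (fun x : StateSpace X => π x.val) q)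
      (target (fun x : StateSpace X => π x.val))) :
    IsVarianceBounding
      (kernelDA (fun x : StateSpace X => π x.val) (fun x : StateSpace X => π' x.val) q)
      (target (fun x : StateSpace X => π x.val)) := by
  have hlog : ContinuousOn (fun x => Real.log (π x / π' x)) (closure X) :=
    (hπ_cont.div hπ'_cont fun x hx => (hπ'_pos x hx).ne').log fun x hx =>
      (div_pos (hπ_pos x hx) (hπ'_pos x hx)).ne'
  refine theorem3_general (N := N.toAddGroupSeminorm) (v := StateSpace.val)
    (measurable_comp_val hπ_cont) (measurable_comp_val hπ'_cont)
    (fun x => hπ_pos _ (subset_closure x.2)) (fun x => hπ'_pos _ (subset_closure x.2)) hπ_one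
    (fun R => (exists_abs_le_of_continuousOn_closure hN hlog R).imp fun L hL x => hL x.val x.2)
    hq hlocal (hheavy.imp fun r hr => hr.2) (fun ε hε => ?_) hMH
  obtain ⟨D, h, -, hbdd, hD⟩ := hΔ ε hε
  exact ⟨D, h, hbdd, hD.mono fun x hx => hx.2⟩
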